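/- A constraint graph is a finite undirected multigraph (loops and parallel edges allowed; each loop contributes two to the degree of its vertex) in which every edge has weight one (a red edge) or weight two (a blue edge). An orientation replaces every edge by a single arc with the same end vertices (parallel edges are oriented individually; a loop has only one orientation); it is feasible if, at every vertex, the total weight of the arcs that enter it is at least two. Two orientations are adjacent if they are equal or differ by the reversal of exactly one arc. An instance of C2C consists of a constraint graph $G$ and two feasible orientations $A_{\mathrm{ini}}, A_{\mathrm{tar}}$ of $G$; the question is whether there is a finite sequence of feasible orientations from $A_{\mathrm{ini}}$ to $A_{\mathrm{tar}}$ in which consecutive members are adjacent. The size of the instance is $|V(G)|+|E(G)|$. An AND vertex is a vertex of degree three with two red edge ends and one blue edge end, an OR vertex is a vertex of degree three with three blue edge ends, and an AND/OR graph is a constraint graph in which every vertex is an AND vertex or an OR vertex. In every AND/OR graph the number of red edges equals the number of AND vertices. Moreover, C2C on AND/OR graphs, parameterized by the number $k'$ of AND vertices, admits a kernel of size $O(k')$: there are a constant $C$ and an algorithm that, given an instance of C2C on an AND/OR graph with $k'$ AND vertices, computes, in time polynomial in the size of the instance, an instance of C2C on an AND/OR graph that has the same answer and whose size and number of AND vertices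 are at most $C\cdot k'$. -/

import Mathlib

namespace NCL

/-! ## Constraint graphs -/

/-- A constraint graph: an undirected multigraph (loops and parallel edges are allowed) with vertex
set `V` and edge set `E`, whose edges have weight one ("red") or two ("blue"). -/
structure ConstraintGraph (V E : Type*) where
  /-- the unordered pair of end vertices of an edge -/
  ends : E → Sym2 V
  /-- the weight of an edge -/
  weight : E → ℕ
  weight_eq : ∀ e, weight e = 1 ∨ weight e = 2

/-- The number of edge ends of weight `w` at the vertex `v`; a loop contributes two. -/
def ConstraintGraph.degree {V E : Type*} [DecidableEq V] [Fintype E] (G : ConstraintGraph V E)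
    (w : ℕ) (v : V) : ℕ :=
  (Finset.univ.filter fun e => G.weight e = w ∧ v ∈ G.ends e).card +
    (Finset.univ.filter fun e => G.weight e = w ∧ G.ends e = s(v, v)).card

/-- An AND vertex: two red edge ends and one blue edge end. -/
def ConstraintGraph.IsAnd {V E : Type*} [DecidableEq V] [Fintype E] (G : ConstraintGraph V E)
    (v : V) : Prop :=
  G.degree 1 v = 2 ∧ G.degree 2 v = 1

/-- An OR vertex: three blue edge ends and no red one. -/
def ConstraintGraph.IsOr {V E : Type*} [DecidableEq V] [Fintype E] (G : ConstraintGraph V E)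
    (v : V) : Prop :=
  G.degree 1 v = 0 ∧ G.degree 2 v = 3

instance {V E : Type*} [DecidableEq V] [Fintype E] (G : ConstraintGraph V E) :
    DecidablePred G.IsAnd :=
  fun _ => inferInstanceAs (Decidable (_ ∧ _))

/-- An AND/OR graph: every vertex is an AND vertex or an OR vertex. -/
def ConstraintGraph.IsAndOr {V E : Type*} [DecidableEq V] [Fintype E]
    (G : ConstraintGraph V E) : Prop :=
  ∀ v, G.IsAnd v ∨ G.IsOr v

/-- The number of red edges. -/
def ConstraintGraph.numRed {V E : Type*} [Fintype E] (G : ConstraintGraph V E) : ℕ :=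
  (Finset.univ.filter fun e => G.weight e = 1).card

/-- The number of AND vertices. -/
def ConstraintGraph.numAnd {V E : Type*} [DecidableEq V] [Fintype V] [Fintype E]
    (G : ConstraintGraph V E) : ℕ :=
  (Finset.univ.filter fun v => G.IsAnd v).card

/-! ## Configurations and reconfiguration -/

/-- An orientation replaces every edge by an arc `(tail, head)` with the same end vertices.
(A loop has only one orientation.) -/
@[ext] structure Orientation {V E : Type*} (G : ConstraintGraph V E) where
  arc : E → V × V
  arc_ends : ∀ e, s((arc e).1, (arc e).2) = G.ends e

/-- The total weight of the arcs that enter `v`. -/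
def Orientation.inWeight {V E : Type*} [DecidableEq V] [Fintype E] {G : ConstraintGraph V E}
    (A : Orientation G) (v : V) : ℕ :=
  ∑ e ∈ Finset.univ.filter (fun e => (A.arc e).2 = v), G.weight e

/-- A feasible orientation (a configuration): the in-weight at each vertex is at least two. -/
def Orientation.Feasible {V E : Type*} [DecidableEq V] [Fintype E] {G : ConstraintGraph V E}
    (A : Orientation G) : Prop :=
  ∀ v, 2 ≤ A.inWeight v

/-- `A ↔ B`: the orientations are equal, or `B` arises from `A` by reversing one arc. -/
def Orientation.Adj {V E : Type*} {G : ConstraintGraph V E} (A B : Orientation G) : Prop :=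
  A = B ∨ ∃ e, B.arc e = (A.arc e).swap ∧ ∀ f, f ≠ e → B.arc f = A.arc f

/-- There is a reconfiguration sequence from `A` to `B`: a finite sequence of feasible orientations
that starts with `A` and ends with `B`, in which consecutive members are adjacent. -/
def Orientation.Reachable {V E : Type*} [DecidableEq V] [Fintype E] {G : ConstraintGraph V E}
    (A B : Orientation G) : Prop :=
  ∃ (l : ℕ) (S : ℕ → Orientation G), S 0 = A ∧ S l = B ∧ (∀ i ≤ l, (S i).Feasible) ∧
    ∀ i < l, (S i).Adj (S (i + 1))

/-- An instance of C2C ("configuration-to-configuration"): a finite constraint graph with vertices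
`0, …, n - 1` and edges `0, …, m - 1`, together with two feasible orientations. -/
structure C2CInstance where
  n : ℕ
  m : ℕ
  graph : ConstraintGraph (Fin n) (Fin m)
  ini : Orientation graph
  tar : Orientation graph
  ini_feasible : ini.Feasible
  tar_feasible : tar.Feasible

/-- The size of an instance: the number of vertices plus the number of edges. -/
def C2CInstance.size (I : C2CInstance) : ℕ := I.n + I.m

/-- The answer to the instance is "yes". -/
def C2CInstance.IsYes (I : C2CInstance) : Prop := I.ini.Reachable I.tar

/-! ## Machine model with a cost measure -/

/-- Data values: finite binary trees (S-expressions over one atom). -/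
inductive Data : Type
  | nil : Data
  | cons : Data → Data → Data


/-- The number of nodes (leaves included) of a data value. -/
def Data.size : Data → ℕ
  | .nil => 1
  | .cons a b => a.size + b.size + 1

/-- The first component of a pair (and `nil` for `nil`). -/
def Data.fst : Data → Data
  | .nil => .nil
  | .cons a _ => a

/-- The second component of a pair (and `nil` for `nil`). -/
def Data.snd : Data → Data
  | .nil => .nil
  | .cons _ b => b

/-- A list of data values as one data value. -/
def Data.ofList : List Data → Data
  | [] => .nil
  | a :: l => .cons a (Data.ofList l)

/-- A natural number in unary, as a list of `nil`s. -/
def Data.ofNat (n : ℕ) : Data := Data.ofList (List.replicate n Data.nil)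

/-- Programs of a small `while` language on data values. A program is finite and transforms one
data value; several variables are held in a tuple. -/
inductive Prog : Type
  | id : Prog
  | nil : Prog
  | fst : Prog
  | snd : Prog
  /-- run both programs on the input and pair their outputs -/
  | pair : Prog → Prog → Prog
  /-- run the first program, then the second one on its output -/
  | seq : Prog → Prog → Prog
  /-- if the first program returns a pair, run the second program on the input, else the third -/
  | ite : Prog → Prog → Prog → Prog
  /-- as long as the first program returns a pair, apply the second program -/
  | loop : Prog → Prog → Prog

/-- `Prog.Eval P x y t`: the program `P`, started on `x`, halts with output `y` at total cost `t`.
An elementary operation costs the size of the value it is applied to (plus one), and every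
control step costs one; so the cost bounds the running time up to a polynomial, and it also bounds
the sizes of all the values that occur. -/
inductive Prog.Eval : Prog → Data → Data → ℕ → Prop
  | id (x : Data) : Prog.Eval .id x x (x.size + 1)
  | nil (x : Data) : Prog.Eval .nil x .nil (x.size + 1)
  | fst (x : Data) : Prog.Eval .fst x x.fst (x.size + 1)
  | snd (x : Data) : Prog.Eval .snd x x.snd (x.size + 1)
  | pair {P Q : Prog} {x y z : Data} {s t : ℕ} :
      Prog.Eval P x y s → Prog.Eval Q x z t → Prog.Eval (.pair P Q) x (.cons y z) (s + t + 1)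
  | seq {P Q : Prog} {x y z : Data} {s t : ℕ} :
      Prog.Eval P x y s → Prog.Eval Q y z t → Prog.Eval (.seq P Q) x z (s + t + 1)
  | ite_true {C P Q : Prog} {x a b y : Data} {s t : ℕ} :
      Prog.Eval C x (.cons a b) s → Prog.Eval P x y t → Prog.Eval (.ite C P Q) x y (s + t + 1)
  | ite_false {C P Q : Prog} {x y : Data} {s t : ℕ} :
      Prog.Eval C x .nil s → Prog.Eval Q x y t → Prog.Eval (.ite C P Q) x y (s + t + 1)
  | loop_done {C P : Prog} {x : Data} {s : ℕ} :
      Prog.Eval C x .nil s → Prog.Eval (.loop C P) x x (s + 1)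
  | loop_step {C P : Prog} {x a b y z : Data} {r s t : ℕ} :
      Prog.Eval C x (.cons a b) r → Prog.Eval P x y s → Prog.Eval (.loop C P) y z t →
      Prog.Eval (.loop C P) x z (r + s + t + 1)

/-- The input and output format for C2C instances: the number of vertices, followed by a list with
one entry per edge, which gives the weight of the edge, its arc in the initial orientation and its
arc in the target orientation. (Each arc shows the end vertices of the edge.) -/
def C2CInstance.encode (I : C2CInstance) : Data :=
  .cons (Data.ofNat I.n) (Data.ofList (List.ofFn fun e : Fin I.m =>
    Data.ofList [Data.ofNat (I.graph.weight e),
      Data.ofNat (I.ini.arc e).1, Data.ofNat (I.ini.arc e).2,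
      Data.ofNat (I.tar.arc e).1, Data.ofNat (I.tar.arc e).2]))

/-! ## Parameterized problems and kernels -/

/-- A parameterized decision problem on a type of encoded instances. -/
structure ParamProblem where
  Inst : Type
  encode : Inst → Data
  size : Inst → ℕ
  IsYes : Inst → Prop
  param : Inst → ℕ

/-- The problem admits a kernel of size `g`: there is a program that transforms each instance with
parameter `k`, in time polynomial in the size of the instance, into an equivalent instance of the
same problem whose size and parameter are at most `g k`. -/
def ParamProblem.HasKernel (Q : ParamProblem) (g : ℕ → ℕ) : Prop :=
  ∃ (P : Prog) (p : Polynomial ℕ), ∀ I : Q.Inst, ∃ (J : Q.Inst) (t : ℕ),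
    P.Eval (Q.encode I) (Q.encode J) t ∧ t ≤ p.eval (Q.size I) ∧
    (Q.IsYes I ↔ Q.IsYes J) ∧ Q.size J ≤ g (Q.param I) ∧ Q.param J ≤ g (Q.param I)

/-- C2C on AND/OR graphs, parameterized by the number of AND vertices. -/
def c2cAndOr : ParamProblem where
  Inst := {I : C2CInstance // I.graph.IsAndOr}
  encode I := I.1.encode
  size I := I.1.size
  IsYes I := I.1.IsYes
  param I := I.1.graph.numAnd

end NCL

namespace NCL

/-! ## Polynomial-time functions -/

/-! The equality is the handshake lemma for red edges: an AND vertex has two red ends and an OR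
vertex none.

For the kernel, consider the components of the graph of blue edges, and call a component free if it
has more edges than vertices. Every orientation then has a surplus in it: a vertex entered by two
blue arcs. Reversing one of these two arcs keeps the orientation feasible and can pass the surplus
on to the other end of the arc, so a surplus travels backwards along directed blue paths
(`exists_push`). The counting argument `not_isFree_of_closed` ensures that a surplus can be reached
from where it is needed. With it, every vertex of a free component can be given an entering blue
arc, whatever happens outside (`exists_agreeOff`). Moreover, a feasible orientation can be
reconfigured into any orientation that differs from it only in free components and in which a blue
arc enters each of their vertices (`AgreeOff.reach`). Hence the state of the free components does
not affect the answer.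

The reduced graph deletes the OR vertices of free components. The blue edge of an AND vertex that
led to a deleted vertex is attached to a new OR vertex with a blue loop; the loop satisfies this
vertex for good, so it never constrains the edge. Sequences project to the reduced graph, and they
lift back by filling the free components with one fixed orientation `F` (`reach_iff_reach_reduce`).

In a non-free component with `a` AND and `o` OR vertices, the handshake lemma gives `a + 3 * o ≤ 2 *
(a + o)`, so `o ≤ a`. Therefore at most `2 * k'` vertices remain, new ones included, and at most `3
* k'` edges because the graph is cubic: size at most `5 * k'`.

The rest shows that the reduction is computed by a polynomial-time `Prog`: `PolyTime` is closed
under the usual list operations (`polyTime_reduce`), and the output of the list algorithm is exactly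
the encoding of the reduced instance (`enc_reduce_code`). -/

/-- Types whose elements are represented by data values. -/
class Enc (α : Type) where
  /-- the representation of an element -/
  enc : α → Data

open Enc (enc)

instance : Enc Unit := ⟨fun _ => .nil⟩
instance : Enc Bool := ⟨fun b => if b = true then .cons .nil .nil else .nil⟩
instance : Enc ℕ := ⟨Data.ofNat⟩
instance {α β : Type} [Enc α] [Enc β] : Enc (α × β) := ⟨fun x => .cons (enc x.1) (enc x.2)⟩
instance {α : Type} [Enc α] : Enc (List α) := ⟨fun l => Data.ofList (l.map enc)⟩

/-- The size of the representation of an element. -/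
def esize {α : Type} [Enc α] (x : α) : ℕ := (enc x).size

section Size
variable {α β : Type} [Enc α] [Enc β]

theorem Data.one_le_size (x : Data) : 1 ≤ x.size := by
  cases x <;> simp [Data.size]

@[simp] theorem esize_prod (x : α × β) : esize x = esize x.1 + esize x.2 + 1 := rfl

@[simp] theorem esize_nil : esize ([] : List α) = 1 := rfl

@[simp] theorem esize_cons (a : α) (l : List α) : esize (a :: l) = esize a + esize l + 1 := rfl

theorem esize_bool_le (b : Bool) : esize b ≤ 3 := by cases b <;> decide

@[simp] theorem esize_nat (n : ℕ) : esize n = 2 * n + 1 := by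
  induction n with
  | zero => rfl
  | succ n ih =>
    have : esize (n + 1) = 1 + esize n + 1 := rfl
    omega

theorem length_le_esize (l : List α) : l.length ≤ esize l := by
  induction l with
  | nil => simp
  | cons a l ih => simp only [List.length_cons, esize_cons]; omega

theorem esize_le_of_mem {l : List α} {a : α} (h : a ∈ l) : esize a ≤ esize l := by
  induction l with
  | nil => simp at h
  | cons b l ih =>
    simp only [List.mem_cons] at h
    rw [esize_cons]
    rcases h with rfl | h
    · omega
    · have := ih h; omega

end Size

theorem Polynomial.eval_mono_nat (p : Polynomial ℕ) {a b : ℕ} (h : a ≤ b) :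
    p.eval a ≤ p.eval b := by
  rw [Polynomial.eval_eq_sum, Polynomial.eval_eq_sum]
  exact Finset.sum_le_sum fun i _ => Nat.mul_le_mul_left _ (Nat.pow_le_pow_left h i)

/-- Since the cost bounds the output size, a time bound doubles as a size bound; compositions and
loops rely on this. -/
theorem Prog.Eval.size_le {P : Prog} {x y : Data} {t : ℕ} (h : P.Eval x y t) :
    x.size ≤ t ∧ y.size ≤ t := by
  induction h with
  | id x => omega
  | nil x => have := x.one_le_size; simp only [Data.size]; omega
  | fst x => cases x <;> simp only [Data.size, Data.fst] <;> omega
  | snd x => cases x <;> simp only [Data.size, Data.snd] <;> omega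
  | pair _ _ h1 h2 => simp only [Data.size]; omega
  | seq _ _ h1 h2 => omega
  | ite_true _ _ h1 h2 => omega
  | ite_false _ _ h1 h2 => omega
  | loop_done _ h1 => omega
  | loop_step _ _ _ h1 h2 h3 => omega

/-- Functions that are computed by a program in polynomial time. -/
def PolyTime {α β : Type} [Enc α] [Enc β] (f : α → β) : Prop :=
  ∃ (P : Prog) (p : Polynomial ℕ), ∀ x, ∃ t, P.Eval (enc x) (enc (f x)) t ∧ t ≤ p.eval (esize x)

namespace PolyTime

variable {α β γ δ σ : Type} [Enc α] [Enc β] [Enc γ] [Enc δ] [Enc σ]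

theorem exists_esize_le {f : α → β} (hf : PolyTime f) :
    ∃ p : Polynomial ℕ, ∀ x, esize (f x) ≤ p.eval (esize x) := by
  obtain ⟨P, p, h⟩ := hf
  refine ⟨p, fun x => ?_⟩
  obtain ⟨t, h1, h2⟩ := h x
  exact h1.size_le.2.trans h2

theorem id : PolyTime (fun x : α => x) :=
  ⟨.id, .X + 1, fun x => ⟨_, .id _, by simp [esize]⟩⟩

theorem comp {g : β → γ} {f : α → β} (hg : PolyTime g) (hf : PolyTime f) :
    PolyTime fun x => g (f x) := by
  obtain ⟨P, p, hP⟩ := hf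
  obtain ⟨Q, q, hQ⟩ := hg
  refine ⟨.seq P Q, p + q.comp p + 1, fun x => ?_⟩
  obtain ⟨s, h1, h2⟩ := hP x
  obtain ⟨t, h3, h4⟩ := hQ (f x)
  refine ⟨_, .seq h1 h3, ?_⟩
  have := Polynomial.eval_mono_nat q (show esize (f x) ≤ _ from h1.size_le.2.trans h2)
  simp only [Polynomial.eval_add, Polynomial.eval_comp, Polynomial.eval_one]
  omega

theorem pair {f : α → β} {g : α → γ} (hf : PolyTime f) (hg : PolyTime g) :
    PolyTime fun x => (f x, g x) := by
  obtain ⟨P, p, hP⟩ := hf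
  obtain ⟨Q, q, hQ⟩ := hg
  refine ⟨.pair P Q, p + q + 1, fun x => ?_⟩
  obtain ⟨s, h1, h2⟩ := hP x
  obtain ⟨t, h3, h4⟩ := hQ x
  refine ⟨_, .pair h1 h3, ?_⟩
  simp only [Polynomial.eval_add, Polynomial.eval_one]
  omega

theorem fst {f : α → β × γ} (hf : PolyTime f) : PolyTime fun x => (f x).1 :=
  comp (g := Prod.fst) ⟨.fst, .X + 1, fun x => ⟨_, .fst _, by simp [esize]⟩⟩ hf

theorem snd {f : α → β × γ} (hf : PolyTime f) : PolyTime fun x => (f x).2 :=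
  comp (g := Prod.snd) ⟨.snd, .X + 1, fun x => ⟨_, .snd _, by simp [esize]⟩⟩ hf

theorem const (b : β) : PolyTime fun _ : α => b := by
  have key : ∀ d : Data, ∃ (P : Prog) (p : Polynomial ℕ),
      ∀ x : Data, ∃ t, P.Eval x d t ∧ t ≤ p.eval x.size := by
    intro d
    induction d with
    | nil => exact ⟨.nil, .X + 1, fun x => ⟨_, .nil _, by simp⟩⟩
    | cons a b iha ihb =>
      obtain ⟨P, p, hP⟩ := iha
      obtain ⟨Q, q, hQ⟩ := ihb
      refine ⟨.pair P Q, p + q + 1, fun x => ?_⟩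
      obtain ⟨s, h1, h2⟩ := hP x
      obtain ⟨t, h3, h4⟩ := hQ x
      refine ⟨_, .pair h1 h3, ?_⟩
      simp only [Polynomial.eval_add, Polynomial.eval_one]
      omega
  obtain ⟨P, p, hP⟩ := key (enc b)
  exact ⟨P, p, fun x => hP (enc x)⟩

theorem ite {c : α → Bool} {f g : α → β} (hc : PolyTime c) (hf : PolyTime f) (hg : PolyTime g) :
    PolyTime fun x => if c x = true then f x else g x := by
  obtain ⟨C, r, hC⟩ := hc
  obtain ⟨P, p, hP⟩ := hf
  obtain ⟨Q, q, hQ⟩ := hg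
  refine ⟨.ite C P Q, r + p + q + 1, fun x => ?_⟩
  obtain ⟨u, h5, h6⟩ := hC x
  obtain ⟨s, h1, h2⟩ := hP x
  obtain ⟨t, h3, h4⟩ := hQ x
  simp only [Polynomial.eval_add, Polynomial.eval_one]
  cases h : c x
  · rw [h] at h5
    exact ⟨_, .ite_false h5 (by simpa using h3), by omega⟩
  · rw [h] at h5
    exact ⟨_, .ite_true h5 (by simpa using h1), by omega⟩

theorem not {b : α → Bool} (hb : PolyTime b) : PolyTime fun x => !b x := by
  convert hb.ite (const false) (const true) using 2 with x
  cases b x <;> rfl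

theorem and {b c : α → Bool} (hb : PolyTime b) (hc : PolyTime c) :
    PolyTime fun x => b x && c x := by
  convert hb.ite hc (const false) using 2 with x
  cases b x <;> rfl

theorem or {b c : α → Bool} (hb : PolyTime b) (hc : PolyTime c) :
    PolyTime fun x => b x || c x := by
  convert hb.ite (const true) hc using 2 with x
  cases b x <;> rfl

theorem cons {f : α → β} {l : α → List β} (hf : PolyTime f) (hl : PolyTime l) :
    PolyTime fun x => f x :: l x := by
  obtain ⟨P, p, h⟩ := hf.pair hl
  exact ⟨P, p, h⟩

/-- In unary the predecessor is the tail of a list, and the convention that the second component of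
`nil` is `nil` matches truncated subtraction. -/
theorem pred {f : α → ℕ} (hf : PolyTime f) : PolyTime fun x => f x - 1 := by
  refine comp (g := fun n : ℕ => n - 1) ⟨.snd, .X + 1, fun n => ⟨esize n + 1, ?_, by simp⟩⟩ hf
  cases n with
  | zero => exact .snd (enc 0)
  | succ n => exact .snd (enc (n + 1))

theorem succ {f : α → ℕ} (hf : PolyTime f) : PolyTime fun x => f x + 1 := by
  obtain ⟨P, p, h⟩ := (const (α := α) ()).pair hf
  exact ⟨P, p, h⟩

/-- A positive unary number is a pair and zero is `nil`, so the program for `f` itself serves as the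
condition of the branch. -/
theorem decide_pos {f : α → ℕ} (hf : PolyTime f) : PolyTime fun x => decide (0 < f x) := by
  obtain ⟨P, p, hP⟩ := hf
  obtain ⟨T, q, hT⟩ := const (α := α) true
  obtain ⟨F, r, hF⟩ := const (α := α) false
  refine ⟨.ite P T F, p + q + r + 1, fun x => ?_⟩
  obtain ⟨u, h5, h6⟩ := hP x
  obtain ⟨s, h1, h2⟩ := hT x
  obtain ⟨t, h3, h4⟩ := hF x
  simp only [Polynomial.eval_add, Polynomial.eval_one]
  cases h : f x
  · rw [h] at h5
    exact ⟨_, .ite_false h5 (by simpa using h3), by omega⟩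
  · rw [h] at h5
    exact ⟨_, .ite_true (show Prog.Eval P _ (.cons .nil (Data.ofNat _)) _ from h5)
      (by simpa using h1), by omega⟩

/-- A loop body: replaces `(a :: l, x, s)` by `(l, x, f (x, s, a))`, where `P` computes `f`. -/
def foldBody (P : Prog) : Prog :=
  .pair (.seq .fst .snd) (.pair (.seq .snd .fst)
    (.seq (.pair (.seq .snd .fst) (.pair (.seq .snd .snd) (.seq .fst .fst))) P))

theorem foldBody_eval {f : γ × σ × α → σ} {P : Prog} {p : Polynomial ℕ}
    (hP : ∀ x, ∃ t, P.Eval (enc x) (enc (f x)) t ∧ t ≤ p.eval (esize x))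
    (a : α) (l : List α) (x : γ) (s : σ) (Z : ℕ) (hZ : esize (a :: l, x, s) ≤ Z) :
    ∃ t, (foldBody P).Eval (enc (a :: l, x, s)) (enc (l, x, f (x, s, a))) t ∧
      t ≤ 10 * Z + 20 + p.eval Z := by
  obtain ⟨t, h1, h2⟩ := hP (x, s, a)
  refine ⟨_, .pair (.seq (.fst _) (.snd _)) (.pair (.seq (.snd _) (.fst _))
    (.seq (.pair (.seq (.snd _) (.fst _)) (.pair (.seq (.snd _) (.snd _))
      (.seq (.fst _) (.fst _)))) h1)), ?_⟩
  have e1 : (enc (a :: l, x, s)).size = esize (a :: l, x, s) := rfl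
  have e2 : (enc (a :: l, x, s)).fst.size = esize (a :: l) := rfl
  have e3 : (enc (a :: l, x, s)).snd.size = esize (x, s) := rfl
  have h3 := Polynomial.eval_mono_nat p
    (show esize (x, s, a) ≤ Z by simp only [esize_prod, esize_cons] at hZ ⊢; omega)
  simp only [esize_prod, esize_cons] at hZ e1 e2 e3
  omega

/-- `M` bounds the present state together with a growth of `c` for each remaining element, and `N`
bounds the remaining list. Both bounds survive a step, so `Z` bounds every triple on which the body
runs. -/
theorem foldLoop_eval {f : γ × σ × α → σ} {P : Prog} {p : Polynomial ℕ}
    (hP : ∀ x, ∃ t, P.Eval (enc x) (enc (f x)) t ∧ t ≤ p.eval (esize x)) (x : γ) (c M N Z : ℕ)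
    (hZ : N + M + esize x + 2 ≤ Z) (l : List α) (s : σ)
    (hc : ∀ a ∈ l, ∀ s, esize (f (x, s, a)) ≤ esize s + c)
    (hM : esize s + l.length * c ≤ M) (hN : esize l ≤ N) :
    ∃ t, (Prog.loop .fst (foldBody P)).Eval (enc (l, x, s))
        (enc (([] : List α), x, l.foldl (fun s a => f (x, s, a)) s)) t ∧
      t ≤ (l.length + 1) * (11 * Z + 22 + p.eval Z) := by
  induction l generalizing s with
  | nil =>
    refine ⟨_, .loop_done (.fst _), ?_⟩
    have e1 : (enc (([] : List α), x, s)).size = esize (([] : List α), x, s) := rfl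
    simp only [esize_prod, esize_nil] at e1
    simp only [List.length_nil] at hM ⊢
    simp only [esize_nil] at hN
    omega
  | cons a l ih =>
    have h1 := hc a (by simp) s
    simp only [List.length_cons, esize_cons] at hM hN ⊢
    obtain ⟨t, ht, htb⟩ := ih (f (x, s, a)) (fun b hb => hc b (by simp [hb]))
      (by nlinarith) (by omega)
    have hs : esize (a :: l, x, s) ≤ Z := by
      simp only [esize_prod, esize_cons]
      have : esize s ≤ M := le_trans (Nat.le_add_right _ _) hM
      omega
    obtain ⟨r, hr, hrb⟩ := foldBody_eval hP a l x s Z hs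
    refine ⟨_, .loop_step (.fst _) hr ht, ?_⟩
    have : (enc (a :: l, x, s)).size ≤ Z := hs
    nlinarith

/-- Folding a polynomial-time function along a list, if one step enlarges the state only by an
amount that does not depend on the state. -/
theorem foldl {f : γ × σ × α → σ} (hf : PolyTime f) {i : γ → σ} (hi : PolyTime i)
    {l : γ → List α} (hl : PolyTime l) (q : Polynomial ℕ)
    (hq : ∀ x, ∀ a ∈ l x, ∀ s, esize (f (x, s, a)) ≤ esize s + q.eval (esize x)) :
    PolyTime fun x => (l x).foldl (fun s a => f (x, s, a)) (i x) := by
  obtain ⟨P, p, hP⟩ := hf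
  obtain ⟨Q, r, hQ⟩ := hl.pair (PolyTime.id.pair hi)
  obtain ⟨ri, hri⟩ := hi.exists_esize_le
  obtain ⟨rl, hrl⟩ := hl.exists_esize_le
  let Z : Polynomial ℕ := rl + (ri + rl * q) + .X + 2
  have hZ : ∀ n, Z.eval n = rl.eval n + (ri.eval n + rl.eval n * q.eval n) + n + 2 := by
    intro n; simp [Z]
  let B : Polynomial ℕ := (rl + 1) * (11 * Z + 22 + p.comp Z)
  have hB : ∀ n, B.eval n = (rl.eval n + 1) * (11 * Z.eval n + 22 + p.eval (Z.eval n)) := by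
    intro n; simp [B]
  -- `B` pays for the loop; `2 * B` pays for the two projections of its result, whose size is at
  -- most the cost of the loop.
  refine ⟨.seq Q (.seq (.loop .fst (foldBody P)) (.seq .snd .snd)), r + B + 2 * B + 10,
    fun x => ?_⟩
  obtain ⟨t, h1, h2⟩ := hQ x
  have hlen : (l x).length ≤ rl.eval (esize x) := (length_le_esize _).trans (hrl x)
  obtain ⟨u, h3, h4⟩ := foldLoop_eval hP x (q.eval (esize x))
    (ri.eval (esize x) + rl.eval (esize x) * q.eval (esize x)) (rl.eval (esize x))
    (Z.eval (esize x)) (by rw [hZ]) (l x) (i x) (hq x)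
    (Nat.add_le_add (hri x) (Nat.mul_le_mul_right _ hlen)) (hrl x)
  refine ⟨_, .seq h1 (.seq h3 (.seq (.snd _) (.snd _))), ?_⟩
  have h5 := h3.size_le.2
  have e1 : ∀ y : List α × γ × σ, (enc y).snd.size ≤ (enc y).size := by
    intro y; change esize y.2 ≤ esize y; rw [esize_prod y]; omega
  have h6 := e1 ([], x, (l x).foldl (fun s a => f (x, s, a)) (i x))
  have h7 : u ≤ B.eval (esize x) := by
    rw [hB]; exact h4.trans (Nat.mul_le_mul_right _ (by omega))
  simp only [Polynomial.eval_add, Polynomial.eval_mul, Polynomial.eval_ofNat]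
  omega

end PolyTime
end NCL
-- Polynomial-time list operations and arithmetic.
namespace NCL
open Enc (enc)
namespace PolyTime

variable {α β γ δ σ : Type} [Enc α] [Enc β] [Enc γ] [Enc δ] [Enc σ]

theorem reverse {l : γ → List α} (hl : PolyTime l) : PolyTime fun x => (l x).reverse := by
  obtain ⟨q, hq⟩ := hl.exists_esize_le
  have h := foldl (f := fun y : γ × List α × α => y.2.2 :: y.2.1) (id.snd.snd.cons id.snd.fst)
    (const []) hl (q + 1) (fun x a ha s => by
      have := (esize_le_of_mem ha).trans (hq x)
      simp only [esize_cons, Polynomial.eval_add, Polynomial.eval_one]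
      omega)
  convert h using 2 with x
  simp

theorem foldr {f : γ × σ × α → σ} (hf : PolyTime f) {i : γ → σ} (hi : PolyTime i)
    {l : γ → List α} (hl : PolyTime l) (q : Polynomial ℕ)
    (hq : ∀ x, ∀ a ∈ l x, ∀ s, esize (f (x, s, a)) ≤ esize s + q.eval (esize x)) :
    PolyTime fun x => (l x).foldr (fun a s => f (x, s, a)) (i x) := by
  convert foldl hf hi hl.reverse q (fun x a ha => hq x a (by simpa using ha)) using 2 with x
  rw [List.foldl_reverse]

theorem exists_esize_le_of_mem {f : γ → α → β} (hf : PolyTime fun y : γ × α => f y.1 y.2)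
    {l : γ → List α} (hl : PolyTime l) :
    ∃ q : Polynomial ℕ, ∀ x, ∀ a ∈ l x, esize (f x a) ≤ q.eval (esize x) := by
  obtain ⟨p, hp⟩ := hf.exists_esize_le
  obtain ⟨q, hq⟩ := hl.exists_esize_le
  refine ⟨p.comp (.X + q + 1), fun x a ha => (hp (x, a)).trans ?_⟩
  rw [Polynomial.eval_comp]
  apply Polynomial.eval_mono_nat
  have := (esize_le_of_mem ha).trans (hq x)
  simp only [esize_prod, Polynomial.eval_add, Polynomial.eval_one, Polynomial.eval_X]
  omega

theorem map {f : γ → α → β} (hf : PolyTime fun y : γ × α => f y.1 y.2)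
    {l : γ → List α} (hl : PolyTime l) : PolyTime fun x => (l x).map (f x) := by
  obtain ⟨q, hq⟩ := exists_esize_le_of_mem hf hl
  have h := foldr (f := fun y : γ × List β × α => f y.1 y.2.2 :: y.2.1)
    ((hf.comp (id.fst.pair id.snd.snd)).cons id.snd.fst) (const []) hl (q + 1)
    (fun x a ha s => by
      have := hq x a ha
      simp only [esize_cons, Polynomial.eval_add, Polynomial.eval_one]
      omega)
  convert h using 2 with x
  induction l x with
  | nil => rfl
  | cons a l ih => rw [List.map_cons, List.foldr_cons, ← ih]

theorem filter {p : γ → α → Bool} (hp : PolyTime fun y : γ × α => p y.1 y.2)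
    {l : γ → List α} (hl : PolyTime l) : PolyTime fun x => (l x).filter (p x) := by
  obtain ⟨q, hq⟩ := hl.exists_esize_le
  have h := foldr (f := fun y : γ × List α × α => if p y.1 y.2.2 = true then y.2.2 :: y.2.1
    else y.2.1) ((hp.comp (id.fst.pair id.snd.snd)).ite (id.snd.snd.cons id.snd.fst) id.snd.fst)
    (const []) hl (q + 1) (fun x a ha s => by
      have := (esize_le_of_mem ha).trans (hq x)
      simp only [Polynomial.eval_add, Polynomial.eval_one]
      split
      · rw [esize_cons]; omega
      · omega)
  convert h using 2 with x
  induction l x with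
  | nil => rfl
  | cons a l ih => simp [List.filter_cons, ih]

theorem any {p : γ → α → Bool} (hp : PolyTime fun y : γ × α => p y.1 y.2)
    {l : γ → List α} (hl : PolyTime l) : PolyTime fun x => (l x).any (p x) := by
  have h := foldr (f := fun y : γ × Bool × α => p y.1 y.2.2 || y.2.1)
    ((hp.comp (id.fst.pair id.snd.snd)).or id.snd.fst) (const false) hl 3 (fun x a ha s => by
      rw [Polynomial.eval_ofNat]
      exact (esize_bool_le _).trans (Nat.le_add_left _ _))
  convert h using 2 with x
  induction l x with
  | nil => rfl
  | cons a l ih => rw [List.any_cons, List.foldr_cons, ← ih]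

theorem append {l m : γ → List α} (hl : PolyTime l) (hm : PolyTime m) :
    PolyTime fun x => l x ++ m x := by
  obtain ⟨q, hq⟩ := hl.exists_esize_le
  have h := foldr (f := fun y : γ × List α × α => y.2.2 :: y.2.1) (id.snd.snd.cons id.snd.fst)
    hm hl (q + 1) (fun x a ha s => by
      have := (esize_le_of_mem ha).trans (hq x)
      simp only [esize_cons, Polynomial.eval_add, Polynomial.eval_one]
      omega)
  convert h using 2 with x
  simp

theorem length {l : γ → List α} (hl : PolyTime l) : PolyTime fun x => (l x).length := by
  have h := foldr (f := fun y : γ × ℕ × α => y.2.1 + 1) id.snd.fst.succ (const 0) hl 2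
    (fun x a ha s => by simp only [esize_nat, Polynomial.eval_ofNat]; omega)
  convert h using 2 with x
  induction l x with
  | nil => rfl
  | cons a l ih => rw [List.length_cons, List.foldr_cons, ← ih]

/-- A unary number and a list of that many units are the same data value, so a bounded iteration is
a fold along such a list. -/
theorem replicate {n : γ → ℕ} (hn : PolyTime n) :
    PolyTime fun x => List.replicate (n x) () := by
  obtain ⟨P, p, h⟩ := hn
  refine ⟨P, p, fun x => ?_⟩
  have : enc (List.replicate (n x) ()) = enc (n x) := by
    change Data.ofList ((List.replicate (n x) ()).map enc) = Data.ofNat (n x)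
    rw [List.map_replicate]; rfl
  rw [this]
  exact h x

theorem iterate {f : γ → σ → σ} (hf : PolyTime fun y : γ × σ => f y.1 y.2) {i : γ → σ}
    (hi : PolyTime i) {n : γ → ℕ} (hn : PolyTime n) (q : Polynomial ℕ)
    (hq : ∀ x s, esize (f x s) ≤ esize s + q.eval (esize x)) :
    PolyTime fun x => (f x)^[n x] (i x) := by
  have h := foldl (f := fun y : γ × σ × Unit => f y.1 y.2.1) (hf.comp (id.fst.pair id.snd.fst))
    hi hn.replicate q (fun x _ _ s => hq x s)
  convert h using 2 with x
  generalize i x = s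
  induction n x generalizing s with
  | zero => rfl
  | succ n ih => rw [Function.iterate_succ_apply, ih]; rfl

theorem sub {f g : γ → ℕ} (hf : PolyTime f) (hg : PolyTime g) :
    PolyTime fun x => f x - g x := by
  have h := iterate (f := fun (_ : γ) (n : ℕ) => n - 1) id.snd.pred hf hg 0
    (fun x s => by simp only [esize_nat]; omega)
  convert h using 2 with x
  exact (Nat.pred_iterate _ _).symm

theorem range {n : γ → ℕ} (hn : PolyTime n) : PolyTime fun x => List.range (n x) := by
  obtain ⟨q, hq⟩ := hn.exists_esize_le
  have h := iterate (f := fun x (s : List ℕ) => (n x - 1 - s.length) :: s)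
    (((hn.comp id.fst).pred.sub id.snd.length).cons id.snd) (const []) hn (q + 1) (fun x s => by
      have := hq x
      simp only [esize_cons, esize_nat, Polynomial.eval_add, Polynomial.eval_one] at this ⊢
      omega)
  convert h using 2 with x
  -- The list is built from its end: after `k` steps it holds the last `k` numbers below `n x`.
  have key : ∀ k ≤ n x, (fun s : List ℕ => (n x - 1 - s.length) :: s)^[k] [] =
      List.range' (n x - k) k := by
    intro k
    induction k with
    | zero => intro _; rfl
    | succ k ih =>
      intro hk
      rw [Function.iterate_succ_apply', ih (by omega), List.range'_succ, List.length_range']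
      congr 1
      · omega
      · congr 1; omega
  rw [key _ le_rfl, Nat.sub_self, List.range_eq_range']

theorem decide_lt {f g : γ → ℕ} (hf : PolyTime f) (hg : PolyTime g) :
    PolyTime fun x => decide (f x < g x) := by
  convert (hg.sub hf).decide_pos using 3 with x
  simp

theorem decide_eq_nat {f g : γ → ℕ} (hf : PolyTime f) (hg : PolyTime g) :
    PolyTime fun x => decide (f x = g x) := by
  convert (hf.decide_lt hg).not.and (hg.decide_lt hf).not using 2 with x
  rw [Bool.eq_iff_iff]
  simp only [decide_eq_true_eq, Bool.and_eq_true, Bool.not_eq_true', decide_eq_false_iff_not]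
  omega

theorem beq_bool {f g : γ → Bool} (hf : PolyTime f) (hg : PolyTime g) :
    PolyTime fun x => f x == g x := by
  convert hf.ite hg hg.not using 2 with x
  cases f x <;> cases g x <;> rfl

theorem idxOf [BEq α] (h : PolyTime fun x : α × α => x.1 == x.2) {a : γ → α}
    (ha : PolyTime a) {l : γ → List α} (hl : PolyTime l) :
    PolyTime fun x => (l x).idxOf (a x) := by
  have h := foldr (f := fun y : γ × ℕ × α => if (y.2.2 == a y.1) = true then 0
    else y.2.1 + 1) ((h.comp (id.snd.snd.pair (ha.comp id.fst))).ite (const 0) id.snd.fst.succ)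
    (const 0) hl 2 (fun x b _ s => by
      simp only [Polynomial.eval_ofNat]
      split <;> simp only [esize_nat] <;> omega)
  convert h using 2 with x
  induction l x with
  | nil => rfl
  | cons b l ih =>
    rw [List.idxOf_cons, List.foldr_cons, ← ih]
    cases b == a x <;> simp

end PolyTime
end NCL
namespace NCL
open Enc (enc)

/-! ## The kernelization algorithm -/

/-- An edge in the input format: its weight and its arcs `(a, b)` and `(c, d)` in the initial and
in the target orientation. -/
abbrev EdgeCode : Type := ℕ × ℕ × ℕ × ℕ × ℕ × Unit

namespace EdgeCode

/-- the weight of the edge -/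
abbrev w (e : EdgeCode) : ℕ := e.1
/-- the tail in the initial orientation -/
abbrev a (e : EdgeCode) : ℕ := e.2.1
/-- the head in the initial orientation -/
abbrev b (e : EdgeCode) : ℕ := e.2.2.1
/-- the tail in the target orientation -/
abbrev c (e : EdgeCode) : ℕ := e.2.2.2.1
/-- the head in the target orientation -/
abbrev d (e : EdgeCode) : ℕ := e.2.2.2.2.1

end EdgeCode

/-- The input format: the number of vertices and the list of edges. -/
abbrev Code : Type := ℕ × List EdgeCode

namespace Code

/-- Membership of a number in a list. -/
def elem (u : ℕ) (C : List ℕ) : Bool := C.any fun v => decide (v = u)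

/-- The vertices that are in `C` or have a blue neighbour in `C`. -/
def expand (I : Code) (C : List ℕ) : List ℕ :=
  (List.range I.1).filter fun u => elem u C || I.2.any fun e => decide (e.w = 2) &&
    (decide (e.a = u) && elem e.b C || decide (e.b = u) && elem e.a C)

/-- The blue component of a vertex. -/
def comp (I : Code) (v : ℕ) : List ℕ := (expand I)^[I.1] [v]

/-- The blue component of `v` has more edges than vertices. -/
def free (I : Code) (v : ℕ) : Bool :=
  decide ((comp I v).length < (I.2.filter fun e => decide (e.w = 2) && elem e.a (comp I v)).length)

/-- The vertex is incident with a red edge, or its blue component is not free. -/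
def keep (I : Code) (v : ℕ) : Bool :=
  (I.2.any fun e => decide (e.w = 1) && (decide (e.a = v) || decide (e.b = v))) || !free I v

/-- The vertex is kept, but one of its neighbours is not. -/
def stub (I : Code) (v : ℕ) : Bool :=
  keep I v && I.2.any fun e =>
    (decide (e.a = v) && !keep I e.b || decide (e.b = v) && !keep I e.a)

/-- The vertices of the reduced instance: the kept vertices, and one new vertex for every stub. -/
def names (I : Code) : List (Bool × ℕ) :=
  ((List.range I.1).filter (keep I)).map (fun v => (false, v)) ++
    ((List.range I.1).filter (stub I)).map (fun v => (true, v))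

/-- The end at `x` of an edge from `x` to `y`, in the reduced instance. -/
def endName (I : Code) (x y : ℕ) : Bool × ℕ := if keep I x = true then (false, x) else (true, y)

/-- The number of a vertex of the reduced instance. -/
def index (I : Code) (x : Bool × ℕ) : ℕ := (names I).idxOf x

/-- An edge of the reduced instance that stems from an edge of the given instance. -/
def reduceEdge (I : Code) (e : EdgeCode) : EdgeCode :=
  (e.w, index I (endName I e.a e.b), index I (endName I e.b e.a),
    index I (endName I e.c e.d), index I (endName I e.d e.c), ())

/-- The loop at the new vertex for a stub. -/
def stubLoop (I : Code) (v : ℕ) : EdgeCode :=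
  (2, index I (true, v), index I (true, v), index I (true, v), index I (true, v), ())

/-- The kernelization. -/
def reduce (I : Code) : Code :=
  ((names I).length, (I.2.filter fun e => keep I e.a || keep I e.b).map (reduceEdge I) ++
    ((List.range I.1).filter (stub I)).map (stubLoop I))

theorem esize_filter_le {α : Type} [Enc α] (p : α → Bool) (l : List α) :
    esize (l.filter p) ≤ esize l := by
  induction l with
  | nil => exact le_rfl
  | cons a l ih =>
    rw [List.filter_cons, esize_cons]
    split
    · rw [esize_cons]; omega
    · omega

/-! ### The kernelization runs in polynomial time. -/

section PolyTime
open PolyTime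
variable {γ : Type} [Enc γ] {I : γ → Code}

theorem polyTime_elem {u : γ → ℕ} {C : γ → List ℕ} (hu : PolyTime u) (hC : PolyTime C) :
    PolyTime fun x => elem (u x) (C x) :=
  any (id.snd.decide_eq_nat (hu.comp id.fst)) hC

theorem polyTime_expand {C : γ → List ℕ} (hI : PolyTime I) (hC : PolyTime C) :
    PolyTime fun x => expand (I x) (C x) := by
  refine filter (p := fun x u => elem u (C x) || (I x).2.any fun e => decide (e.w = 2) &&
    (decide (e.a = u) && elem e.b (C x) || decide (e.b = u) && elem e.a (C x)))
    (.or (polyTime_elem id.snd (hC.comp id.fst)) (any (p := fun (x : γ × ℕ) (e : EdgeCode) =>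
      decide (e.w = 2) && (decide (e.a = x.2) && elem e.b (C x.1) ||
      decide (e.b = x.2) && elem e.a (C x.1))) ?_ (hI.comp id.fst).snd)) hI.fst.range
  have hC' : PolyTime fun y : (γ × ℕ) × EdgeCode => C y.1.1 := hC.comp id.fst.fst
  exact .and (decide_eq_nat id.snd.fst (const 2))
    (.or (.and (decide_eq_nat id.snd.snd.fst id.fst.snd) (polyTime_elem id.snd.snd.snd.fst hC'))
      (.and (decide_eq_nat id.snd.snd.snd.fst id.fst.snd) (polyTime_elem id.snd.snd.fst hC')))

theorem polyTime_comp {v : γ → ℕ} (hI : PolyTime I) (hv : PolyTime v) :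
    PolyTime fun x => comp (I x) (v x) := by
  obtain ⟨q, hq⟩ := hI.fst.range.exists_esize_le
  refine iterate (f := fun x C => expand (I x) C) (polyTime_expand (hI.comp id.fst) id.snd)
    (hv.cons (const [])) hI.fst q fun x s => ?_
  -- Each new set is a filtered `List.range`, so its size has a bound that does not depend on the
  -- previous set.
  refine le_trans ?_ ((hq x).trans (Nat.le_add_left _ _))
  exact esize_filter_le _ _

theorem polyTime_free {v : γ → ℕ} (hI : PolyTime I) (hv : PolyTime v) :
    PolyTime fun x => free (I x) (v x) := by
  have hc := polyTime_comp hI hv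
  exact decide_lt hc.length (length (filter
    (p := fun x (e : EdgeCode) => decide (e.w = 2) && elem e.a (comp (I x) (v x)))
    (.and (decide_eq_nat id.snd.fst (const 2))
    (polyTime_elem id.snd.snd.fst (hc.comp id.fst))) hI.snd))

theorem polyTime_keep {v : γ → ℕ} (hI : PolyTime I) (hv : PolyTime v) :
    PolyTime fun x => keep (I x) (v x) := by
  have hv' : PolyTime fun y : γ × EdgeCode => v y.1 := hv.comp id.fst
  exact .or (any (p := fun x (e : EdgeCode) =>
    decide (e.w = 1) && (decide (e.a = v x) || decide (e.b = v x)))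
    (.and (decide_eq_nat id.snd.fst (const 1))
    (.or (decide_eq_nat id.snd.snd.fst hv') (decide_eq_nat id.snd.snd.snd.fst hv'))) hI.snd)
    (polyTime_free hI hv).not

theorem polyTime_stub {v : γ → ℕ} (hI : PolyTime I) (hv : PolyTime v) :
    PolyTime fun x => stub (I x) (v x) := by
  have hv' : PolyTime fun y : γ × EdgeCode => v y.1 := hv.comp id.fst
  have hI' : PolyTime fun y : γ × EdgeCode => I y.1 := hI.comp id.fst
  exact .and (polyTime_keep hI hv) (any (p := fun x (e : EdgeCode) =>
    (decide (e.a = v x) && !keep (I x) e.b || decide (e.b = v x) && !keep (I x) e.a)) (.or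
    (.and (decide_eq_nat id.snd.snd.fst hv') (polyTime_keep hI' id.snd.snd.snd.fst).not)
    (.and (decide_eq_nat id.snd.snd.snd.fst hv') (polyTime_keep hI' id.snd.snd.fst).not)) hI.snd)

theorem polyTime_names (hI : PolyTime I) : PolyTime fun x => names (I x) :=
  append
    (map (f := fun _ v => (false, v)) (pair (const false) id.snd)
      (filter (p := fun x v => keep (I x) v) (polyTime_keep (hI.comp id.fst) id.snd) hI.fst.range))
    (map (f := fun _ v => (true, v)) (pair (const true) id.snd)
      (filter (p := fun x v => stub (I x) v) (polyTime_stub (hI.comp id.fst) id.snd) hI.fst.range))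

theorem polyTime_endName {x y : γ → ℕ} (hI : PolyTime I) (hx : PolyTime x) (hy : PolyTime y) :
    PolyTime fun z => endName (I z) (x z) (y z) :=
  (polyTime_keep hI hx).ite (pair (const false) hx) (pair (const true) hy)

theorem polyTime_index {x : γ → Bool × ℕ} (hI : PolyTime I) (hx : PolyTime x) :
    PolyTime fun z => index (I z) (x z) :=
  idxOf (.and (beq_bool id.fst.fst id.snd.fst) (decide_eq_nat id.fst.snd id.snd.snd)) hx
    (polyTime_names hI)

theorem polyTime_reduceEdge {e : γ → EdgeCode} (hI : PolyTime I) (he : PolyTime e) :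
    PolyTime fun z => reduceEdge (I z) (e z) := by
  have ha := he.snd.fst
  have hb := he.snd.snd.fst
  have hc := he.snd.snd.snd.fst
  have hd := he.snd.snd.snd.snd.fst
  exact he.fst.pair (.pair (polyTime_index hI (polyTime_endName hI ha hb))
    (.pair (polyTime_index hI (polyTime_endName hI hb ha))
    (.pair (polyTime_index hI (polyTime_endName hI hc hd))
    (.pair (polyTime_index hI (polyTime_endName hI hd hc)) (const ())))))

theorem polyTime_stubLoop {v : γ → ℕ} (hI : PolyTime I) (hv : PolyTime v) :
    PolyTime fun z => stubLoop (I z) (v z) := by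
  have h := polyTime_index hI (pair (const true) hv)
  exact (const 2).pair (h.pair (h.pair (h.pair (h.pair (const ())))))

theorem polyTime_reduce : PolyTime reduce :=
  pair (polyTime_names id).length (append
    (map (f := reduceEdge) (polyTime_reduceEdge id.fst id.snd)
      (filter (p := fun I (e : EdgeCode) => keep I e.a || keep I e.b) (.or
        (polyTime_keep id.fst id.snd.snd.fst) (polyTime_keep id.fst id.snd.snd.snd.fst)) id.snd))
    (map (f := stubLoop) (polyTime_stubLoop id.fst id.snd)
      (filter (p := stub) (polyTime_stub id.fst id.snd) id.fst.range)))

end PolyTime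
end Code
end NCL
namespace NCL

/-! ## Degrees and blue components -/

section Degree
variable {V E : Type} {G : ConstraintGraph V E}

theorem Orientation.mem_ends (A : Orientation G) {e : E} {v : V} :
    v ∈ G.ends e ↔ v = (A.arc e).1 ∨ v = (A.arc e).2 := by
  rw [← A.arc_ends e, Sym2.mem_iff]

theorem Orientation.arc_eq_or (A B : Orientation G) (e : E) :
    B.arc e = A.arc e ∨ B.arc e = (A.arc e).swap := by
  have h := (B.arc_ends e).trans (A.arc_ends e).symm
  rw [Sym2.eq_iff] at h
  rcases h with ⟨h1, h2⟩ | ⟨h1, h2⟩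
  · exact .inl (Prod.ext h1 h2)
  · exact .inr (Prod.ext h1 h2)

theorem Orientation.nonempty (G : ConstraintGraph V E) : Nonempty (Orientation G) :=
  ⟨⟨fun e => (G.ends e).out, fun e => Quot.out_eq (G.ends e)⟩⟩

variable [DecidableEq V] [Fintype E]

/-- The edges incident with `v` are the union of those with tail `v` and those with head `v`, and
the loops are the intersection; so this is inclusion-exclusion. -/
theorem ConstraintGraph.degree_eq (A : Orientation G) (w : ℕ) (v : V) :
    G.degree w v = (Finset.univ.filter fun e => G.weight e = w ∧ (A.arc e).1 = v).card +
      (Finset.univ.filter fun e => G.weight e = w ∧ (A.arc e).2 = v).card := by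
  classical
  rw [← Finset.card_union_add_card_inter, ConstraintGraph.degree]
  congr 2
  · ext e
    simp only [Finset.mem_filter, Finset.mem_univ, true_and, Finset.mem_union, A.mem_ends]
    tauto
  · ext e
    simp only [Finset.mem_filter, Finset.mem_univ, true_and, Finset.mem_inter, ← A.arc_ends e,
      Sym2.eq_iff]
    tauto

theorem sum_card_fiber {α : Type} [Fintype α] (K : Finset V) (p : α → Prop) [DecidablePred p]
    (f : α → V) :
    ∑ v ∈ K, (Finset.univ.filter fun e => p e ∧ f e = v).card =
      (Finset.univ.filter fun e => p e ∧ f e ∈ K).card := by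
  rw [Finset.card_eq_sum_card_fiberwise (f := f) (t := K)]
  · refine Finset.sum_congr rfl fun v hv => congrArg _ ?_
    ext e
    simp only [Finset.mem_filter, Finset.mem_univ, true_and]
    constructor
    · rintro ⟨h1, rfl⟩; exact ⟨⟨h1, hv⟩, rfl⟩
    · rintro ⟨⟨h1, -⟩, h2⟩; exact ⟨h1, h2⟩
  · intro e he
    simpa using (Finset.mem_filter.1 he).2.2

/-- The handshake lemma, for the edges of one weight in a union of components. -/
theorem sum_degree (A : Orientation G) (w : ℕ) (K : Finset V)
    (hK : ∀ e, G.weight e = w → ((A.arc e).1 ∈ K ↔ (A.arc e).2 ∈ K)) :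
    ∑ v ∈ K, G.degree w v =
      2 * (Finset.univ.filter fun e => G.weight e = w ∧ (A.arc e).1 ∈ K).card := by
  simp only [G.degree_eq A, Finset.sum_add_distrib]
  rw [sum_card_fiber K (fun e => G.weight e = w) (fun e => (A.arc e).1),
    sum_card_fiber K (fun e => G.weight e = w) (fun e => (A.arc e).2), two_mul]
  congr 2
  ext e
  simp only [Finset.mem_filter, Finset.mem_univ, true_and]
  exact and_congr_right fun h => (hK e h).symm

theorem ConstraintGraph.not_isOr_of_isAnd {v : V} (h : G.IsAnd v) : ¬ G.IsOr v := fun h' => by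
  have := h.1; have := h'.1; omega

theorem sum_degree_univ [Fintype V] (w : ℕ) :
    ∑ v, G.degree w v = 2 * (Finset.univ.filter fun e => G.weight e = w).card := by
  obtain ⟨A⟩ := Orientation.nonempty G
  simpa using sum_degree A w Finset.univ (by simp)

theorem ConstraintGraph.IsAndOr.numRed_eq_numAnd [Fintype V] (hG : G.IsAndOr) :
    G.numRed = G.numAnd := by
  have h := sum_degree_univ (G := G) 1
  have h2 : ∑ v, G.degree 1 v = 2 * G.numAnd := by
    rw [ConstraintGraph.numAnd, Finset.card_filter, Finset.mul_sum]
    refine Finset.sum_congr rfl fun v _ => ?_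
    rcases hG v with hv | hv
    · rw [if_pos hv, hv.1, mul_one]
    · rw [if_neg fun h => G.not_isOr_of_isAnd h hv, hv.1, mul_zero]
  rw [ConstraintGraph.numRed]
  omega

/-- The graph is cubic, so the handshake lemmas for both weights add up to this. It turns a bound on
the vertices of the kernel into one on its edges. -/
theorem ConstraintGraph.IsAndOr.two_mul_card_edges [Fintype V] (hG : G.IsAndOr) :
    2 * Fintype.card E = 3 * Fintype.card V := by
  have h1 := sum_degree_univ (G := G) 1
  have h2 := sum_degree_univ (G := G) 2
  have h3 : ∑ v, (G.degree 1 v + G.degree 2 v) = 3 * Fintype.card V := by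
    rw [Finset.sum_congr rfl (g := fun _ => 3)]
    · simp [mul_comm]
    · intro v _
      rcases hG v with hv | hv <;> rw [hv.1, hv.2]
  rw [Finset.sum_add_distrib] at h3
  have h4 : (Finset.univ.filter fun e => G.weight e = 1).card +
      (Finset.univ.filter fun e => G.weight e = 2).card = Fintype.card E := by
    have h5 : (Finset.univ.filter fun e => G.weight e = 2) =
        Finset.univ.filter fun e => ¬ G.weight e = 1 :=
      Finset.filter_congr fun e _ => by rcases G.weight_eq e with h | h <;> simp [h]
    rw [h5, Finset.card_filter_add_card_filter_not, Finset.card_univ]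
  omega

end Degree

section Component
variable {V E : Type} (G : ConstraintGraph V E)

/-- The two vertices are joined by a blue edge. -/
def ConstraintGraph.BlueAdj (u v : V) : Prop := ∃ e, G.weight e = 2 ∧ G.ends e = s(u, v)

theorem ConstraintGraph.BlueAdj.symm {u v : V} (h : G.BlueAdj u v) : G.BlueAdj v u := by
  obtain ⟨e, h1, h2⟩ := h
  exact ⟨e, h1, h2.trans Sym2.eq_swap⟩

/-- The two vertices are in the same component of the graph of blue edges. -/
def ConstraintGraph.BlueConn : V → V → Prop := Relation.ReflTransGen G.BlueAdj

variable {G} in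
theorem ConstraintGraph.BlueConn.symm {u v : V} (h : G.BlueConn u v) : G.BlueConn v u := by
  induction h with
  | refl => exact .refl
  | tail _ hb ih => exact .head (hb.symm G) ih

variable {G} in
theorem ConstraintGraph.BlueConn.trans {u v w : V} (h : G.BlueConn u v) (h' : G.BlueConn v w) :
    G.BlueConn u w := Relation.ReflTransGen.trans h h'

open Classical in
/-- The component of a vertex in the graph of blue edges. -/
noncomputable def ConstraintGraph.blueComp [Fintype V] (v : V) : Finset V :=
  Finset.univ.filter (G.BlueConn v)

open Classical in
/-- The blue component of the vertex has more edges than vertices. -/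
def ConstraintGraph.IsFree [Fintype V] [Fintype E] (v : V) : Prop :=
  (G.blueComp v).card <
    (Finset.univ.filter fun e => G.weight e = 2 ∧ ∃ u ∈ G.ends e, G.BlueConn v u).card

/-- A blue edge of a free component. -/
def ConstraintGraph.IsFreeEdge [Fintype V] [Fintype E] (e : E) : Prop :=
  G.weight e = 2 ∧ ∀ v ∈ G.ends e, G.IsFree v

variable {G}

theorem Orientation.blueConn (A : Orientation G) {e : E} (he : G.weight e = 2) :
    G.BlueConn (A.arc e).1 (A.arc e).2 :=
  .single ⟨e, he, (A.arc_ends e).symm⟩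

variable [Fintype V]

theorem ConstraintGraph.mem_blueComp {u v : V} : u ∈ G.blueComp v ↔ G.BlueConn v u := by
  simp [ConstraintGraph.blueComp]

theorem ConstraintGraph.self_mem_blueComp (v : V) : v ∈ G.blueComp v :=
  G.mem_blueComp.2 .refl

theorem ConstraintGraph.BlueConn.blueComp_eq {u v : V} (h : G.BlueConn u v) :
    G.blueComp u = G.blueComp v := by
  ext x
  rw [mem_blueComp, mem_blueComp]
  exact ⟨h.symm.trans, h.trans⟩

theorem Orientation.mem_blueComp_iff (A : Orientation G) {e : E} (he : G.weight e = 2) (v : V) :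
    (A.arc e).1 ∈ G.blueComp v ↔ (A.arc e).2 ∈ G.blueComp v := by
  rw [G.mem_blueComp, G.mem_blueComp]
  exact ⟨fun h => h.trans (A.blueConn he), fun h => h.trans (A.blueConn he).symm⟩

theorem Orientation.blueComp_subset (A : Orientation G) {R : Set V} {v : V} (hv : v ∈ R)
    (h1 : ∀ e, G.weight e = 2 → ((A.arc e).1 ∈ R ↔ (A.arc e).2 ∈ R)) {u : V}
    (hu : u ∈ G.blueComp v) : u ∈ R := by
  replace hu := G.mem_blueComp.1 hu
  induction hu with
  | refl => exact hv
  | tail _ hb ih =>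
    obtain ⟨e, he, hbe⟩ := hb
    have := h1 e he
    rw [← A.arc_ends e, Sym2.eq_iff] at hbe
    rcases hbe with ⟨h, h'⟩ | ⟨h, h'⟩ <;> rw [h, h'] at this <;> tauto

variable [Fintype E]

/-- Both ends of a blue edge lie in the same component, so its edges may be counted by their tails,
as the algorithm does. -/
theorem Orientation.isFree_iff [DecidableEq V] (A : Orientation G) {v : V} : G.IsFree v ↔ (G.blueComp v).card <
    (Finset.univ.filter fun e => G.weight e = 2 ∧ (A.arc e).1 ∈ G.blueComp v).card := by
  rw [ConstraintGraph.IsFree]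
  apply iff_of_eq
  congr 2
  ext e
  simp only [Finset.mem_filter, Finset.mem_univ, true_and, ← G.mem_blueComp, A.mem_ends]
  refine and_congr_right fun h => ?_
  have := A.mem_blueComp_iff h v
  constructor
  · rintro ⟨u, rfl | rfl, hu⟩ <;> tauto
  · exact fun hu => ⟨_, .inl rfl, hu⟩

theorem ConstraintGraph.BlueConn.isFree_iff {u v : V} (h : G.BlueConn u v) :
    G.IsFree u ↔ G.IsFree v := by
  classical
  obtain ⟨A⟩ := Orientation.nonempty G
  rw [A.isFree_iff, A.isFree_iff, h.blueComp_eq]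

theorem ConstraintGraph.isFreeEdge_of_mem {e : E} {v : V} (he : G.weight e = 2)
    (hv : v ∈ G.ends e) (hf : G.IsFree v) : G.IsFreeEdge e := by
  refine ⟨he, fun u hu => ?_⟩
  obtain ⟨A⟩ := Orientation.nonempty G
  rw [A.mem_ends] at hu hv
  have h := (A.blueConn he).isFree_iff
  rcases hu with rfl | rfl <;> rcases hv with rfl | rfl <;> tauto

end Component
end NCL
namespace NCL

/-! ## Reconfiguration in free components -/

namespace Orientation

section Step
variable {V E : Type} [DecidableEq V] [Fintype E] {G : ConstraintGraph V E}

theorem Adj.symm {V E : Type} {G : ConstraintGraph V E} {A B : Orientation G} (h : A.Adj B) :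
    B.Adj A := by
  rcases h with h | ⟨e, h1, h2⟩
  · exact .inl h.symm
  · exact .inr ⟨e, by rw [h1, Prod.swap_swap], fun f hf => (h2 f hf).symm⟩

/-- Adjacency of feasible orientations. -/
def Step (A B : Orientation G) : Prop := A.Feasible ∧ B.Feasible ∧ A.Adj B

/-- Two feasible orientations are joined by a reconfiguration sequence. -/
def Reach : Orientation G → Orientation G → Prop := Relation.ReflTransGen Step

theorem Reach.symm {A B : Orientation G} (h : Reach A B) : Reach B A := by
  induction h with
  | refl => exact .refl
  | tail _ hb ih => exact .head ⟨hb.2.1, hb.1, hb.2.2.symm⟩ ih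

theorem Reach.trans {A B C : Orientation G} (h : Reach A B) (h' : Reach B C) : Reach A C :=
  Relation.ReflTransGen.trans h h'

/-- Feasibility of `A` matters for the sequence of length zero: `Reach` is reflexive on all
orientations, whereas a reconfiguration sequence consists of feasible ones. -/
theorem reachable_iff {A B : Orientation G} (hA : A.Feasible) : A.Reachable B ↔ Reach A B := by
  constructor
  · rintro ⟨l, S, rfl, rfl, h1, h2⟩
    have key : ∀ i ≤ l, Reach (S 0) (S i) := by
      intro i
      induction i with
      | zero => exact fun _ => .refl
      | succ i ih =>
        exact fun hi => .tail (ih (by omega)) ⟨h1 i (by omega), h1 (i + 1) hi, h2 i (by omega)⟩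
    exact key l le_rfl
  · intro h
    induction h with
    | refl => exact ⟨0, fun _ => A, rfl, rfl, fun _ _ => hA, by simp⟩
    | @tail B C _ hb ih =>
      obtain ⟨l, S, h1, h2, h3, h4⟩ := ih
      refine ⟨l + 1, fun i => if i ≤ l then S i else C, by simpa using h1, by simp, ?_, ?_⟩
      · intro i _
        by_cases hi : i ≤ l
        · simpa [hi] using h3 i hi
        · simpa [hi] using hb.2.1
      · intro i hi
        have hi' : i ≤ l := by omega
        rcases Nat.lt_or_ge i l with h | h
        · have : i + 1 ≤ l := h
          simpa [hi', this] using h4 i h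
        · obtain rfl : i = l := by omega
          simpa [h2] using hb.2.2

end Step

/-! ### Reversal of a blue arc whose head has a surplus. -/

section Flip
variable {V E : Type} {G : ConstraintGraph V E}

/-- Reversal of one arc. -/
def flip [DecidableEq E] (A : Orientation G) (f : E) : Orientation G where
  arc e := if e = f then (A.arc f).swap else A.arc e
  arc_ends e := by
    split
    · subst e
      exact Sym2.eq_swap.trans (A.arc_ends f)
    · exact A.arc_ends e

section
variable [DecidableEq E]

@[simp] theorem flip_arc_self (A : Orientation G) (f : E) : (A.flip f).arc f = (A.arc f).swap :=
  if_pos rfl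

theorem flip_arc_of_ne (A : Orientation G) {e f : E} (h : e ≠ f) :
    (A.flip f).arc e = A.arc e := if_neg h

theorem adj_flip (A : Orientation G) (f : E) : A.Adj (A.flip f) :=
  .inr ⟨f, A.flip_arc_self f, fun _ h => A.flip_arc_of_ne h⟩

end

variable [DecidableEq V] [Fintype E]

/-- The number of blue arcs that enter a vertex. -/
def blueIn (A : Orientation G) (v : V) : ℕ :=
  (Finset.univ.filter fun e => G.weight e = 2 ∧ (A.arc e).2 = v).card

theorem one_le_blueIn {A : Orientation G} {v : V} :
    1 ≤ A.blueIn v ↔ ∃ e, G.weight e = 2 ∧ (A.arc e).2 = v := by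
  rw [blueIn, Nat.one_le_iff_ne_zero, Finset.card_ne_zero]
  exact ⟨fun ⟨e, he⟩ => ⟨e, by simpa using he⟩, fun ⟨e, he⟩ => ⟨e, by simpa using he⟩⟩

theorem eq_of_blueIn_le_one {A : Orientation G} {v : V} (h : A.blueIn v ≤ 1) {e f : E}
    (he : G.weight e = 2) (hev : (A.arc e).2 = v) (hf : G.weight f = 2)
    (hfv : (A.arc f).2 = v) : e = f :=
  Finset.card_le_one.1 h e (by simp [he, hev]) f (by simp [hf, hfv])

theorem blueIn_mono {A B : Orientation G} {v : V}
    (h : ∀ e, G.weight e = 2 → (A.arc e).2 = v → (B.arc e).2 = v) : A.blueIn v ≤ B.blueIn v := by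
  refine Finset.card_le_card fun e he => ?_
  simp only [Finset.mem_filter, Finset.mem_univ, true_and] at he ⊢
  exact ⟨he.1, h e he.1 he.2⟩

theorem two_le_inWeight {A : Orientation G} {v : V} (h : 1 ≤ A.blueIn v) : 2 ≤ A.inWeight v := by
  obtain ⟨e, he, hv⟩ := one_le_blueIn.1 h
  rw [← he]
  exact Finset.single_le_sum (f := G.weight) (fun _ _ => Nat.zero_le _) (by simpa using hv)

theorem inWeight_mono {A B : Orientation G} {v : V}
    (h : ∀ e, (A.arc e).2 = v → (B.arc e).2 = v) : A.inWeight v ≤ B.inWeight v := by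
  refine Finset.sum_le_sum_of_subset fun e he => ?_
  simp only [Finset.mem_filter, Finset.mem_univ, true_and] at he ⊢
  exact h e he

variable [DecidableEq E]

/-- The form without subtraction also covers loops, for which both indicators agree. -/
theorem blueIn_flip (A : Orientation G) {f : E} (hf : G.weight f = 2) (v : V) :
    (A.flip f).blueIn v + (if (A.arc f).2 = v then 1 else 0) =
      A.blueIn v + (if (A.arc f).1 = v then 1 else 0) := by
  have h : ∀ B : Orientation G, B.blueIn v = (if (B.arc f).2 = v then 1 else 0) +
      ∑ e ∈ Finset.univ.erase f, if G.weight e = 2 ∧ (B.arc e).2 = v then 1 else 0 := by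
    intro B
    rw [blueIn, Finset.card_filter, ← Finset.add_sum_erase _ _ (Finset.mem_univ f)]
    simp [hf]
  rw [h, h A, flip_arc_self]
  have : ∑ e ∈ Finset.univ.erase f, (if G.weight e = 2 ∧ ((A.flip f).arc e).2 = v then 1 else 0) =
      ∑ e ∈ Finset.univ.erase f, if G.weight e = 2 ∧ (A.arc e).2 = v then 1 else 0 :=
    Finset.sum_congr rfl fun e he => by rw [A.flip_arc_of_ne (Finset.ne_of_mem_erase he)]
  rw [this]
  simp only [Prod.snd_swap]
  omega

theorem one_le_blueIn_flip {A : Orientation G} {f : E} (hf : G.weight f = 2)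
    (h : 2 ≤ A.blueIn (A.arc f).2) {v : V} (hv : 1 ≤ A.blueIn v) : 1 ≤ (A.flip f).blueIn v := by
  have := A.blueIn_flip hf v
  by_cases hv : (A.arc f).2 = v
  · subst hv; rw [if_pos rfl] at this; omega
  · rw [if_neg hv] at this; omega

/-- Only the head of the arc can lose weight, and a single blue arc that still enters it suffices.
-/
theorem feasible_flip {A : Orientation G} (hA : A.Feasible) {f : E} (hf : G.weight f = 2)
    (h : 2 ≤ A.blueIn (A.arc f).2) : (A.flip f).Feasible := by
  intro v
  by_cases hv : (A.arc f).2 = v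
  · subst hv
    exact two_le_inWeight (one_le_blueIn_flip hf h (by omega))
  · refine (hA v).trans (inWeight_mono fun e he => ?_)
    rwa [flip_arc_of_ne]
    rintro rfl
    exact hv he

theorem reach_flip {A : Orientation G} (hA : A.Feasible) {f : E} (hf : G.weight f = 2)
    (h : 2 ≤ A.blueIn (A.arc f).2) : Reach A (A.flip f) :=
  .single ⟨hA, feasible_flip hA hf h, A.adj_flip f⟩

end Flip

/-! ### Moving a surplus backwards along a directed blue path. -/

section Path
variable {V E : Type} {G : ConstraintGraph V E}

/-- There is a directed path of `n` blue arcs from `u` to `v`. -/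
inductive BluePath (A : Orientation G) : ℕ → V → V → Prop
  | nil (u : V) : BluePath A 0 u u
  | snoc {n : ℕ} {u v w : V} {f : E} : BluePath A n u v → G.weight f = 2 → A.arc f = (v, w) →
      BluePath A (n + 1) u w

/-- A path that used `f` would reach the head of `f` within `n` steps, so the path avoids `f` and
survives its reversal. -/
theorem BluePath.flip [DecidableEq E] {A : Orientation G} {n : ℕ} {b u : V}
    (h : A.BluePath n b u) (f : E) (hf : ∀ m ≤ n, ¬ A.BluePath m b (A.arc f).2) :
    (A.flip f).BluePath n b u := by
  induction h with
  | nil => exact .nil _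
  | @snoc n b v w e h he hev ih =>
    refine .snoc (ih fun m hm => hf m (by omega)) he (hev ▸ A.flip_arc_of_ne ?_)
    rintro rfl
    exact hf (n + 1) le_rfl (.snoc h he (by rw [hev]))

theorem BluePath.blueConn {A : Orientation G} {n : ℕ} {u v : V} (h : A.BluePath n u v) :
    G.BlueConn u v := by
  induction h with
  | nil => exact .refl
  | snoc _ hf hfv ih => exact ih.trans (by simpa [hfv] using A.blueConn hf)

variable [DecidableEq V] [Fintype E] [DecidableEq E]

/-- If a vertex with two entering blue arcs can be reached from `B`, then such a vertex can be
moved next to `B` by reversals of arcs that avoid `B`. -/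
theorem exists_push (B : Set V) (Good : Orientation G → Prop)
    (hGood : ∀ X f, Good X → G.weight f = 2 → 2 ≤ X.blueIn (X.arc f).2 → (X.arc f).2 ∉ B →
      (X.arc f).1 ∉ B → (∃ b ∈ B, G.BlueConn b (X.arc f).2) → Good (X.flip f)) (n : ℕ) {X : Orientation G} {b z : V} (hX : Good X)
    (hb : b ∈ B) (hp : X.BluePath n b z) (hz : 2 ≤ X.blueIn z) :
    ∃ X', Good X' ∧ ((∃ b ∈ B, 2 ≤ X'.blueIn b) ∨ ∃ f, G.weight f = 2 ∧ (X'.arc f).1 ∈ B ∧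
      (X'.arc f).2 ∉ B ∧ 2 ≤ X'.blueIn (X'.arc f).2) := by
  induction n using Nat.strong_induction_on generalizing X z with
  | _ n ih =>
    cases hp with
    | nil => exact ⟨X, hX, .inl ⟨_, hb, hz⟩⟩
    | @snoc n _ u _ f hp hf hfu =>
      by_cases hzB : z ∈ B
      · exact ⟨X, hX, .inl ⟨z, hzB, hz⟩⟩
      by_cases huB : u ∈ B
      · exact ⟨X, hX, .inr ⟨f, hf, by rwa [hfu], by rwa [hfu], by rwa [hfu]⟩⟩
      -- Replacing the path by a shorter one where possible ensures that `z` is not within `n` steps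
      -- of `b`; then reversing the last arc does not damage the path to `u`.
      by_cases hshort : ∃ m ≤ n, X.BluePath m b z
      · obtain ⟨m, hm, hp'⟩ := hshort
        exact ih m (by omega) hX hp' hz
      · push Not at hshort
        have hp' := hp.flip f (by rwa [hfu])
        refine ih n (by omega)
          (hGood X f hX hf (by rwa [hfu]) (by rwa [hfu]) (by rwa [hfu])
            ⟨b, hb, by rw [hfu]; exact (hp.snoc hf hfu).blueConn⟩) hp' ?_
        -- The path to `u` is not empty because `u` is outside `B`; its last arc enters `u`, and the
        -- reversed arc is a second one, so the surplus has moved from `z` to `u`.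
        have hu : 1 ≤ X.blueIn u := by
          cases hp with
          | nil => exact absurd hb huB
          | snoc _ hg hgu => exact one_le_blueIn.2 ⟨_, hg, by rw [hgu]⟩
        have hne : z ≠ u := by
          rintro rfl
          exact hshort n le_rfl hp
        have := X.blueIn_flip hf u
        rw [hfu, if_neg hne, if_pos rfl] at this
        omega

end Path

/-! ### Free components can be filled and reconfigured at will. -/

section Reconfiguration
set_option linter.unusedSectionVars false
variable {V E : Type} [DecidableEq V] [Fintype V] [Fintype E] {G : ConstraintGraph V E}

/-- A set of vertices that is closed under blue arcs meets no free component, if none of its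
vertices has two entering blue arcs, and blue arcs from inside enter all of its vertices that are
entered at all. -/
theorem not_isFree_of_closed (A : Orientation G) (R : Set V)
    (h1 : ∀ e, G.weight e = 2 → (A.arc e).1 ∈ R → (A.arc e).2 ∈ R)
    (h2 : ∀ v ∈ R, A.blueIn v ≤ 1)
    (h3 : ∀ v ∈ R, 1 ≤ A.blueIn v → ∃ e, G.weight e = 2 ∧ (A.arc e).2 = v ∧ (A.arc e).1 ∈ R)
    {v : V} (hv : v ∈ R) : ¬ G.IsFree v := by
  classical
  -- The only blue arc into a vertex of `R` is the one from inside that `h3` provides, so `R` is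
  -- also closed backwards and contains the whole blue component of `v`. Counting the edges of the
  -- component by their heads then gives at most one per vertex.
  have hcl : ∀ e, G.weight e = 2 → ((A.arc e).1 ∈ R ↔ (A.arc e).2 ∈ R) := by
    refine fun e he => ⟨h1 e he, fun h => ?_⟩
    obtain ⟨f, hf, hfv, hfR⟩ := h3 _ h (one_le_blueIn.2 ⟨e, he, rfl⟩)
    rwa [eq_of_blueIn_le_one (h2 _ h) he rfl hf hfv]
  rw [A.isFree_iff, not_lt, Finset.card_eq_sum_ones (G.blueComp v)]
  have h4 := sum_card_fiber (G.blueComp v) (fun e => G.weight e = 2) (fun e => (A.arc e).2)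
  have h5 : (Finset.univ.filter fun e => G.weight e = 2 ∧ (A.arc e).1 ∈ G.blueComp v) =
      Finset.univ.filter fun e => G.weight e = 2 ∧ (A.arc e).2 ∈ G.blueComp v :=
    Finset.filter_congr fun e _ => and_congr_right fun he => A.mem_blueComp_iff he v
  rw [h5, ← h4]
  exact Finset.sum_le_sum fun u hu => h2 u (A.blueComp_subset hv hcl hu)

/-- If `W` meets a free component, then a vertex with two entering blue arcs can be reached from
`W`, provided that every vertex of `W` with one entering blue arc is entered by an arc from `W`. -/
theorem exists_bluePath (A : Orientation G) (W : Set V)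
    (hW : ∀ v ∈ W, A.blueIn v = 1 → ∃ e, G.weight e = 2 ∧ (A.arc e).2 = v ∧ (A.arc e).1 ∈ W)
    {v : V} (hv : v ∈ W) (hfree : G.IsFree v) :
    ∃ n, ∃ w ∈ W, ∃ z, A.BluePath n w z ∧ 2 ≤ A.blueIn z := by
  by_contra! hcon
  -- If no surplus could be reached, the set of vertices reachable from `W` would satisfy the
  -- hypotheses of the counting lemma.
  refine A.not_isFree_of_closed {z | ∃ n, ∃ w ∈ W, A.BluePath n w z} ?_ ?_ ?_
    ⟨0, v, hv, .nil v⟩ hfree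
  · rintro e he ⟨n, w, hw, hp⟩
    exact ⟨n + 1, w, hw, .snoc hp he rfl⟩
  · rintro z ⟨n, w, hw, hp⟩
    have := hcon n w hw z hp
    omega
  · rintro z ⟨n, w, hw, hp⟩ hz
    cases hp with
    | nil =>
      have := hcon 0 z hw z (.nil z)
      obtain ⟨e, h1, h2, h3⟩ := hW z hw (by omega)
      exact ⟨e, h1, h2, 0, _, h3, .nil _⟩
    | snoc hp he hev => exact ⟨_, he, by rw [hev], _, w, hw, by rwa [hev]⟩

/-- The orientations differ only in free components. -/
def AgreeOff (A B : Orientation G) : Prop := ∀ e, ¬ G.IsFreeEdge e → A.arc e = B.arc e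

/-- A vertex of a free component is satisfied by one blue arc; at any other vertex no incident edge
is free, so all arcs that enter it in `A` are inherited. -/
theorem AgreeOff.feasible {A B : Orientation G} (h : A.AgreeOff B) (hA : A.Feasible)
    (hB : ∀ v, G.IsFree v → 1 ≤ B.blueIn v) : B.Feasible := by
  intro v
  by_cases hv : G.IsFree v
  · exact two_le_inWeight (hB v hv)
  · refine (hA v).trans (inWeight_mono fun e he => ?_)
    rwa [← h e fun hf => hv (hf.2 v (A.mem_ends.2 (.inr he.symm)))]

theorem AgreeOff.flip {V E : Type} [Fintype V] [Fintype E] {G : ConstraintGraph V E}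
    [DecidableEq E] {A B : Orientation G} (h : A.AgreeOff B) {f : E}
    (hf : G.IsFreeEdge f) : A.AgreeOff (B.flip f) := fun e he =>
  (h e he).trans (B.flip_arc_of_ne fun h' => he (by rwa [h'])).symm

/-- The edges of free components can be oriented such that a blue arc enters each of their
vertices. -/
theorem exists_agreeOff (A : Orientation G) :
    ∃ B : Orientation G, A.AgreeOff B ∧ ∀ v, G.IsFree v → 1 ≤ B.blueIn v := by
  classical
  let bad (X : Orientation G) : Finset V :=
    Finset.univ.filter fun v => G.IsFree v ∧ X.blueIn v = 0
  have mem_bad : ∀ X v, v ∈ bad X ↔ G.IsFree v ∧ X.blueIn v = 0 := by simp [bad]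
  suffices H : ∀ (n : ℕ) (X : Orientation G), A.AgreeOff X → (bad X).card = n →
      ∃ B : Orientation G, A.AgreeOff B ∧ ∀ v, G.IsFree v → 1 ≤ B.blueIn v from
    H _ A (fun _ _ => rfl) rfl
  intro n
  induction n using Nat.strong_induction_on with
  | _ n ih =>
  intro X hX hn
  by_cases hbad : ∃ a, a ∈ bad X
  swap
  · push Not at hbad
    refine ⟨X, hX, fun v hv => ?_⟩
    have := hbad v
    rw [mem_bad] at this
    by_contra h
    exact this ⟨hv, by omega⟩
  obtain ⟨a, ha⟩ := hbad
  -- No blue arc enters a bad vertex, so the condition on vertices with one entering arc is vacuous.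
  obtain ⟨m, w, hw, z, hp, hz⟩ := X.exists_bluePath {v | v ∈ bad X} (fun v hv h => by
    have := ((mem_bad X v).1 hv).2; omega) ha ((mem_bad X a).1 ha).1
  obtain ⟨Y, ⟨hAY, hbad⟩, h⟩ := exists_push {v | v ∈ bad X}
    (fun Y => A.AgreeOff Y ∧ bad Y = bad X)
    (by
      rintro Y f ⟨hAY, hbad⟩ hf hf2 hfB hfB' ⟨b, hb, hbf⟩
      have hfree : G.IsFreeEdge f := G.isFreeEdge_of_mem hf (Y.mem_ends.2 (.inr rfl))
          (hbf.isFree_iff.1 ((mem_bad _ _).1 hb).1)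
      refine ⟨hAY.flip hfree, ?_⟩
      rw [← hbad]
      rw [← hbad] at hfB hfB'
      ext v
      rw [mem_bad, mem_bad]
      refine and_congr_right fun hv => ⟨fun h => ?_, fun h => ?_⟩
      · by_contra h'
        have := one_le_blueIn_flip hf hf2 (v := v) (by omega)
        omega
      · have hvb := (mem_bad Y v).2 ⟨hv, h⟩
        have := Y.blueIn_flip hf v
        rw [if_neg, if_neg] at this
        · omega
        · rintro rfl; exact hfB' hvb
        · rintro rfl; exact hfB hvb) m ⟨hX, rfl⟩ hw hp hz
  -- The surplus cannot be at a bad vertex, so it is next to one; reversing the arc between them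
  -- repairs the bad vertex and spoils no other.
  rcases h with ⟨b, hb, hb2⟩ | ⟨f, hf, hf1, hf2, hf3⟩
  · rw [Set.mem_ofPred_eq, ← hbad, mem_bad] at hb
    omega
  · have hfree : G.IsFreeEdge f := G.isFreeEdge_of_mem hf (Y.mem_ends.2 (.inl rfl))
      ((mem_bad _ _).1 hf1).1
    refine ih _ ?_ (Y.flip f) (hAY.flip hfree) rfl
    rw [← hn, ← hbad]
    rw [← hbad] at hf1 hf2
    refine Finset.card_lt_card (Finset.ssubset_iff_of_subset ?_ |>.2 ⟨_, hf1, ?_⟩)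
    · intro v hv
      rw [mem_bad] at hv ⊢
      refine ⟨hv.1, ?_⟩
      by_contra h
      have := one_le_blueIn_flip hf hf3 (v := v) (by omega)
      omega
    · rw [mem_bad]
      have := Y.blueIn_flip hf (Y.arc f).1
      rw [if_neg fun h => hf2 (by rw [Set.mem_ofPred_eq, h]; exact hf1), if_pos rfl] at this
      omega

open Classical in
/-- The edges that have different arcs. -/
noncomputable def diff {V E : Type} [Fintype E] {G : ConstraintGraph V E} (X Y : Orientation G) : Finset E :=
  Finset.univ.filter fun e => X.arc e ≠ Y.arc e

theorem mem_diff {V E : Type} [Fintype E] {G : ConstraintGraph V E} {X Y : Orientation G} {e : E} : e ∈ diff X Y ↔ X.arc e ≠ Y.arc e := by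
  simp [diff]

/-- Two feasible orientations that differ only in free components, whose vertices are all entered
by blue arcs in the second one. -/
structure Close (X Y : Orientation G) : Prop where
  left : X.Feasible
  right : Y.Feasible
  free : ∀ e ∈ diff X Y, G.IsFreeEdge e
  pos : ∀ v, G.IsFree v → 1 ≤ Y.blueIn v

section
variable [DecidableEq E]

theorem diff_flip_left {X Y : Orientation G} {e : E} (he : e ∈ diff X Y) :
    diff (X.flip e) Y = (diff X Y).erase e := by
  ext f
  rw [mem_diff, Finset.mem_erase, mem_diff]
  by_cases h : f = e
  · subst f
    have := (X.arc_eq_or Y e).resolve_left (Ne.symm (mem_diff.1 he))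
    simp [this]
  · simp [h, X.flip_arc_of_ne h]

theorem diff_comm {V E : Type} [Fintype E] {G : ConstraintGraph V E} (X Y : Orientation G) : diff X Y = diff Y X := by
  ext e
  rw [mem_diff, mem_diff, ne_comm]

theorem diff_flip_right {X Y : Orientation G} {e : E} (he : e ∈ diff X Y) :
    diff X (Y.flip e) = (diff X Y).erase e := by
  rw [diff_comm, diff_flip_left (by rwa [diff_comm]), diff_comm]

theorem diff_flip_flip {X Y : Orientation G} {e : E} (he : e ∉ diff X Y) :
    diff (X.flip e) (Y.flip e) = diff X Y := by
  ext f
  rw [mem_diff, mem_diff]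
  by_cases h : f = e
  · subst f
    have : X.arc e = Y.arc e := by simpa [mem_diff] using he
    simp [this]
  · rw [X.flip_arc_of_ne h, Y.flip_arc_of_ne h]

theorem Close.flip_left {X Y : Orientation G} (h : Close X Y) {e : E} (he : e ∈ diff X Y)
    (h2 : 2 ≤ X.blueIn (X.arc e).2) : Close (X.flip e) Y :=
  ⟨feasible_flip h.left (h.free e he).1 h2, h.right, fun f hf => h.free f (by
    rw [diff_flip_left he] at hf; exact Finset.mem_of_mem_erase hf), h.pos⟩

theorem Close.flip_right {X Y : Orientation G} (h : Close X Y) {e : E} (he : e ∈ diff X Y)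
    (h2 : 2 ≤ Y.blueIn (Y.arc e).2) : Close X (Y.flip e) :=
  ⟨h.left, feasible_flip h.right (h.free e he).1 h2, fun f hf => h.free f (by
    rw [diff_flip_right he] at hf; exact Finset.mem_of_mem_erase hf),
    fun v hv => one_le_blueIn_flip (h.free e he).1 h2 (h.pos v hv)⟩

theorem Close.flip_flip {X Y : Orientation G} (h : Close X Y) {e : E} (he : e ∉ diff X Y)
    (hw : G.weight e = 2) (h2 : 2 ≤ X.blueIn (X.arc e).2) (h3 : 2 ≤ Y.blueIn (Y.arc e).2) :
    Close (X.flip e) (Y.flip e) :=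
  ⟨feasible_flip h.left hw h2, feasible_flip h.right hw h3, fun f hf => h.free f (by
    rwa [diff_flip_flip he] at hf), fun v hv => one_le_blueIn_flip hw h3 (h.pos v hv)⟩

end

/-- Blue arcs to a vertex that is the head of no arc that differs. -/
theorem blueIn_le_of_diff {X Y : Orientation G} {v : V}
    (h : ∀ e ∈ diff X Y, (X.arc e).2 ≠ v) : X.blueIn v ≤ Y.blueIn v := by
  refine blueIn_mono fun e _ hev => ?_
  by_cases he : e ∈ diff X Y
  · exact absurd hev (h e he)
  · rw [mem_diff, not_not] at he
    rwa [← he]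

/-- The ends of the edges that have different arcs. -/
def diffEnds {V E : Type} [Fintype E] {G : ConstraintGraph V E} (X Y : Orientation G) : Set V := {v | ∃ e ∈ diff X Y, v ∈ G.ends e}

/-- A differing arc that enters a surplus vertex can be reversed at once. If none enters `b` in the
orientation with the surplus, all its blue arcs into `b` are shared, so both orientations have a
surplus at `b`; but a differing edge at `b` enters `b` in one of them. -/
theorem Close.exists_decrease {X Y : Orientation G} (h : Close X Y) {b : V}
    (hb : b ∈ diffEnds X Y) (h2 : 2 ≤ X.blueIn b ∨ 2 ≤ Y.blueIn b) :
    ∃ X' Y', Reach X X' ∧ Reach Y Y' ∧ Close X' Y' ∧ (diff X' Y').card < (diff X Y).card := by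
  classical
  by_cases hX : 2 ≤ X.blueIn b ∧ ∃ e ∈ diff X Y, (X.arc e).2 = b
  · obtain ⟨hX, e, he, rfl⟩ := hX
    refine ⟨X.flip e, Y, reach_flip h.left (h.free e he).1 hX, .refl, h.flip_left he hX, ?_⟩
    rw [diff_flip_left he]
    exact Finset.card_erase_lt_of_mem he
  by_cases hY : 2 ≤ Y.blueIn b ∧ ∃ e ∈ diff X Y, (Y.arc e).2 = b
  · obtain ⟨hY, e, he, rfl⟩ := hY
    refine ⟨X, Y.flip e, .refl, reach_flip h.right (h.free e he).1 hY, h.flip_right he hY, ?_⟩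
    rw [diff_flip_right he]
    exact Finset.card_erase_lt_of_mem he
  exfalso
  have h3 : 2 ≤ X.blueIn b ∧ 2 ≤ Y.blueIn b := by
    rcases h2 with h2 | h2
    · refine ⟨h2, h2.trans (blueIn_le_of_diff fun e he heb => hX ⟨h2, e, he, heb⟩)⟩
    · refine ⟨h2.trans (blueIn_le_of_diff fun e he heb => hY ⟨h2, e, ?_, heb⟩), h2⟩
      rwa [diff_comm]
  obtain ⟨e, he, hbe⟩ := hb
  have h4 := (X.arc_eq_or Y e).resolve_left (Ne.symm (mem_diff.1 he))
  rcases X.mem_ends.1 hbe with rfl | rfl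
  · exact hY ⟨h3.2, e, he, by rw [h4]; rfl⟩
  · exact hX ⟨h3.1, e, he, rfl⟩

/-- Without a surplus at `diffEnds`, the differing arcs of `X` have distinct heads. At such a head,
`Y` needs an entering blue arc, which must come from a differing edge, so each head is also a tail.
By cardinality the sets of heads and tails coincide, and `Orientation.exists_bluePath` applies to
this set. -/
theorem Close.exists_bluePath {X Y : Orientation G} (h : Close X Y) (hne : (diff X Y).Nonempty) :
    ∃ n, ∃ b ∈ diffEnds X Y, ∃ z, X.BluePath n b z ∧ 2 ≤ X.blueIn z := by
  classical
  by_contra! hcon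
  have hle : ∀ v ∈ diffEnds X Y, X.blueIn v ≤ 1 := fun v hv => by
    have := hcon 0 v hv v (.nil v); omega
  have hhead : ∀ e ∈ diff X Y, (X.arc e).2 ∈ diffEnds X Y := fun e he =>
    ⟨e, he, X.mem_ends.2 (.inr rfl)⟩
  let W := (diff X Y).image fun e => (X.arc e).2
  have hcard : W.card = (diff X Y).card := Finset.card_image_of_injOn fun e he f hf hef =>
    eq_of_blueIn_le_one (hle _ (hhead e he)) (h.free e he).1 rfl (h.free f hf).1 hef.symm
  have hsub : W ⊆ (diff X Y).image fun e => (X.arc e).1 := by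
    intro w hw
    obtain ⟨e, he, rfl⟩ := Finset.mem_image.1 hw
    obtain ⟨f, hf, hfe⟩ := one_le_blueIn.1
      (h.pos _ ((h.free e he).2 _ (X.mem_ends.2 (.inr rfl))))
    have hfd : f ∈ diff X Y := by
      by_contra hfd
      have : X.arc f = Y.arc f := by simpa [mem_diff] using hfd
      rw [← this] at hfe
      have := eq_of_blueIn_le_one (hle _ (hhead e he)) (h.free e he).1 rfl hf hfe
      exact hfd (this ▸ he)
    refine Finset.mem_image.2 ⟨f, hfd, ?_⟩
    rw [← hfe, (X.arc_eq_or Y f).resolve_left (Ne.symm (mem_diff.1 hfd))]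
    rfl
  have heq := Finset.eq_of_subset_of_card_le hsub (by rw [hcard]; exact Finset.card_image_le)
  obtain ⟨e, he⟩ := hne
  obtain ⟨n, w, hw, z, hp, hz⟩ := X.exists_bluePath {v | v ∈ W} (by
    intro v hv _
    obtain ⟨f, hf, rfl⟩ := Finset.mem_image.1 hv
    exact ⟨f, (h.free f hf).1, rfl, by
      rw [Set.mem_ofPred_eq, heq]; exact Finset.mem_image_of_mem _ hf⟩)
    (Finset.mem_image_of_mem _ he) ((h.free e he).2 _ (X.mem_ends.2 (.inr rfl)))
  obtain ⟨f, hf, rfl⟩ := Finset.mem_image.1 hw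
  have := hcon n _ (hhead f hf) z hp
  omega

/-- The surplus of `X` is pushed towards the differing edges by the same reversals in both
orientations. Away from `diffEnds` they agree on the arcs that enter a vertex of `X`, so each
reversal is legal in `Y` too and leaves `diff` unchanged. -/
theorem Close.exists_lt {X Y : Orientation G} (h : Close X Y) (hne : (diff X Y).Nonempty) :
    ∃ X' Y', Reach X X' ∧ Reach Y Y' ∧ Close X' Y' ∧ (diff X' Y').card < (diff X Y).card := by
  classical
  obtain ⟨n, b, hb, z, hp, hz⟩ := h.exists_bluePath hne
  have hflip : ∀ (X' Y' : Orientation G) f, Close X' Y' → diff X' Y' = diff X Y → G.weight f = 2 →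
      2 ≤ X'.blueIn (X'.arc f).2 → (X'.arc f).2 ∉ diffEnds X Y →
      f ∉ diff X' Y' ∧ X'.arc f = Y'.arc f ∧ 2 ≤ Y'.blueIn (Y'.arc f).2 := by
    intro X' Y' f hc hd hf hf2 hfB
    have hfd : f ∉ diff X' Y' := fun hfd => hfB ⟨f, hd ▸ hfd, X'.mem_ends.2 (.inr rfl)⟩
    have hfe : X'.arc f = Y'.arc f := by simpa [mem_diff] using hfd
    refine ⟨hfd, hfe, ?_⟩
    rw [← hfe]
    exact hf2.trans (blueIn_le_of_diff fun e he heb =>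
      hfB ⟨e, hd ▸ he, X'.mem_ends.2 (.inr heb.symm)⟩)
  obtain ⟨X', ⟨Y', hXX, hYY, hc, hd⟩, hend⟩ := exists_push (diffEnds X Y)
    (fun X' => ∃ Y', Reach X X' ∧ Reach Y Y' ∧ Close X' Y' ∧ diff X' Y' = diff X Y)
    (by
      rintro X' f ⟨Y', hXX, hYY, hc, hd⟩ hf hf2 hfB - -
      obtain ⟨hfd, -, hf3⟩ := hflip X' Y' f hc hd hf hf2 hfB
      exact ⟨Y'.flip f, hXX.trans (reach_flip hc.left hf hf2),
        hYY.trans (reach_flip hc.right hf hf3), hc.flip_flip hfd hf hf2 hf3,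
        (diff_flip_flip hfd).trans hd⟩)
    n ⟨Y, .refl, .refl, h, rfl⟩ hb hp hz
  have hends : ∀ X' Y' : Orientation G, diff X' Y' = diff X Y → diffEnds X' Y' = diffEnds X Y :=
    fun X' Y' hd => by simp only [diffEnds, hd]
  suffices H : ∃ X' Y', Reach X X' ∧ Reach Y Y' ∧ Close X' Y' ∧ diff X' Y' = diff X Y ∧
      ∃ b ∈ diffEnds X' Y', 2 ≤ X'.blueIn b ∨ 2 ≤ Y'.blueIn b by
    obtain ⟨X', Y', hXX, hYY, hc, hd, b, hb, hb2⟩ := H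
    obtain ⟨X'', Y'', h1, h2, h3, h4⟩ := hc.exists_decrease hb hb2
    exact ⟨X'', Y'', hXX.trans h1, hYY.trans h2, h3, hd ▸ h4⟩
  rcases hend with ⟨b, hb, hb2⟩ | ⟨f, hf, hf1, hf2, hf3⟩
  · exact ⟨X', Y', hXX, hYY, hc, hd, b, by rwa [hends X' Y' hd], .inl hb2⟩
  · obtain ⟨hfd, hfe, hf4⟩ := hflip X' Y' f hc hd hf hf3 hf2
    have hd' := (diff_flip_flip hfd).trans hd
    -- The last reversal adds a blue arc at a vertex of `diffEnds`. The surplus is claimed for `Y'`,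
    -- since only there is the vertex known to have had a blue arc before.
    refine ⟨X'.flip f, Y'.flip f, hXX.trans (reach_flip hc.left hf hf3),
      hYY.trans (reach_flip hc.right hf hf4), hc.flip_flip hfd hf hf3 hf4, hd',
      (X'.arc f).1, by rwa [hends _ _ hd'], .inr ?_⟩
    obtain ⟨e, he, hbe⟩ := hf1
    have hpos := hc.pos _ ((h.free e he).2 _ hbe)
    have := Y'.blueIn_flip hf (X'.arc f).1
    rw [← hfe, if_neg fun (hz : (X'.arc f).2 = (X'.arc f).1) => hf2 (hz ▸ ⟨e, he, hbe⟩),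
      if_pos rfl] at this
    omega

theorem Close.reach {X Y : Orientation G} (h : Close X Y) : Reach X Y := by
  induction hn : (diff X Y).card using Nat.strong_induction_on generalizing X Y with
  | _ n ih =>
    by_cases hne : (diff X Y).Nonempty
    · obtain ⟨X', Y', h1, h2, h3, h4⟩ := h.exists_lt hne
      exact h1.trans ((ih _ (hn ▸ h4) h3 rfl).trans h2.symm)
    · have : X = Y := by
        ext1
        funext e
        by_contra he
        exact hne ⟨e, mem_diff.2 he⟩
      exact this ▸ .refl

/-- Two feasible orientations that differ only in free components are joined by a reconfiguration
sequence, if a blue arc enters each vertex of these components in the second one. -/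
theorem AgreeOff.reach {A B : Orientation G} (h : A.AgreeOff B) (hA : A.Feasible)
    (hB : ∀ v, G.IsFree v → 1 ≤ B.blueIn v) : Reach A B :=
  Close.reach ⟨hA, h.feasible hA hB, fun e he => by
    by_contra hf
    exact mem_diff.1 he (h e hf), hB⟩

end Reconfiguration
end Orientation
end NCL
namespace NCL

/-! ## The reduced graph -/

section Count
variable {V E : Type} [DecidableEq V] [Fintype E] {G : ConstraintGraph V E}

namespace Orientation

/-- The number of arcs of weight `w` that enter `v`. -/
def inCount (A : Orientation G) (w : ℕ) (v : V) : ℕ :=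
  (Finset.univ.filter fun e => G.weight e = w ∧ (A.arc e).2 = v).card

/-- Reversal of all arcs. -/
def reverse {V E : Type} {G : ConstraintGraph V E} (A : Orientation G) : Orientation G :=
  ⟨fun e => (A.arc e).swap, fun e => Sym2.eq_swap.trans (A.arc_ends e)⟩

/-- Via `reverse`, formulas for degrees follow from those for entering arcs alone. -/
theorem degree_eq_inCount (A : Orientation G) (w : ℕ) (v : V) :
    G.degree w v = A.reverse.inCount w v + A.inCount w v := G.degree_eq A w v

theorem inWeight_eq (A : Orientation G) (v : V) :
    A.inWeight v = A.inCount 1 v + 2 * A.inCount 2 v := by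
  rw [inWeight, inCount, inCount, Finset.card_filter, Finset.card_filter, Finset.mul_sum,
    Finset.sum_filter, ← Finset.sum_add_distrib]
  refine Finset.sum_congr rfl fun e _ => ?_
  by_cases h : (A.arc e).2 = v <;> rcases G.weight_eq e with h' | h' <;> simp [h, h']

theorem weight_eq_two_of_isOr (A : Orientation G) {e : E} {v : V} (hv : G.IsOr v)
    (he : v ∈ G.ends e) : G.weight e = 2 := by
  refine (G.weight_eq e).resolve_left fun hw => ?_
  have h := hv.1
  rw [G.degree_eq A, Nat.add_eq_zero_iff, Finset.card_eq_zero, Finset.card_eq_zero] at h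
  rcases A.mem_ends.1 he with h' | h'
  · exact Finset.eq_empty_iff_forall_notMem.1 h.1 e (by simp [hw, h'])
  · exact Finset.eq_empty_iff_forall_notMem.1 h.2 e (by simp [hw, h'])

end Orientation
end Count

namespace ConstraintGraph
section Reduced
variable {V E : Type} [DecidableEq V] [Fintype V] [Fintype E] (G : ConstraintGraph V E)

/-- The vertex remains in the reduced graph. -/
def Keep (v : V) : Prop := G.IsAnd v ∨ ¬ G.IsFree v

/-- The vertex remains in the reduced graph, but one of its neighbours does not. -/
def IsStub (v : V) : Prop := G.Keep v ∧ ∃ u, ¬ G.Keep u ∧ ∃ e, G.ends e = s(v, u)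

/-- The vertices of the reduced graph: the kept vertices, and one new vertex for every stub. -/
def IsName (x : Bool × V) : Prop := if x.1 = true then G.IsStub x.2 else G.Keep x.2

/-- The edges that remain in the reduced graph. -/
def KeepEdge (e : E) : Prop := ∃ v ∈ G.ends e, G.Keep v

/-- The edges of the reduced graph: the kept edges and a loop for every stub. -/
abbrev ReducedEdge : Type := {e : E // G.KeepEdge e} ⊕ {v : V // G.IsStub v}

noncomputable instance : DecidablePred G.IsFree := Classical.decPred _
noncomputable instance : DecidablePred G.IsFreeEdge := Classical.decPred _
noncomputable instance : DecidablePred G.Keep := Classical.decPred _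
noncomputable instance : DecidablePred G.IsStub := Classical.decPred _
noncomputable instance : DecidablePred G.IsName := Classical.decPred _
noncomputable instance : DecidablePred G.KeepEdge := Classical.decPred _
instance : DecidablePred G.IsOr := fun _ => inferInstanceAs (Decidable (_ ∧ _))

/-- The vertices are joined by a kept edge. -/
def KeepAdj (x y : V) : Prop := (G.Keep x ∨ G.Keep y) ∧ ∃ e, G.ends e = s(x, y)

variable {G}

/-- A kept vertex. -/
def keptVert {v : V} (hv : G.Keep v) : {x // G.IsName x} := ⟨(false, v), hv⟩

/-- The new vertex for a stub. -/
def newVert {v : V} (hv : G.IsStub v) : {x // G.IsName x} := ⟨(true, v), hv⟩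

theorem keptVert_inj {u v : V} (hu : G.Keep u) (hv : G.Keep v) :
    G.keptVert hu = G.keptVert hv ↔ u = v := by
  simp [Subtype.ext_iff, keptVert]

theorem newVert_inj {u v : V} (hu : G.IsStub u) (hv : G.IsStub v) :
    G.newVert hu = G.newVert hv ↔ u = v := by
  simp [Subtype.ext_iff, newVert]

theorem newVert_ne_keptVert {u v : V} (hu : G.IsStub u) (hv : G.Keep v) :
    G.newVert hu ≠ G.keptVert hv := by
  simp [Subtype.ext_iff, newVert, keptVert]

theorem KeepAdj.symm {x y : V} (h : G.KeepAdj x y) : G.KeepAdj y x :=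
  ⟨h.1.symm, h.2.imp fun _ he => he.trans Sym2.eq_swap⟩

theorem KeepAdj.isStub {x y : V} (h : G.KeepAdj x y) (hx : ¬ G.Keep x) : G.IsStub y :=
  ⟨h.1.resolve_left hx, x, hx, h.symm.2⟩

theorem KeepEdge.keepAdj (A : Orientation G) {e : E} (he : G.KeepEdge e) :
    G.KeepAdj (A.arc e).1 (A.arc e).2 := by
  obtain ⟨v, hv, hk⟩ := he
  refine ⟨?_, e, (A.arc_ends e).symm⟩
  rcases A.mem_ends.1 hv with rfl | rfl
  · exact .inl hk
  · exact .inr hk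

/-- The end at `x` of a kept edge from `x` to `y`, in the reduced graph. -/
noncomputable def endName {x y : V} (h : G.KeepAdj x y) : {x // G.IsName x} :=
  if hx : G.Keep x then G.keptVert hx else
    G.newVert (h.isStub hx)

theorem endName_of_keep {x y : V} (h : G.KeepAdj x y) (hx : G.Keep x) :
    G.endName h = G.keptVert hx := dif_pos hx

theorem endName_of_not_keep {x y : V} (h : G.KeepAdj x y) (hx : ¬ G.Keep x) :
    G.endName h = G.newVert (h.isStub hx) := dif_neg hx

theorem endName_eq_keptVert_iff {x y v : V} (h : G.KeepAdj x y) (hv : G.Keep v) :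
    G.endName h = G.keptVert hv ↔ x = v := by
  by_cases hx : G.Keep x
  · rw [endName_of_keep h hx, keptVert_inj]
  · rw [endName_of_not_keep h hx]
    exact ⟨fun h' => absurd h' (newVert_ne_keptVert _ _), fun h' => absurd (h' ▸ hv) hx⟩

theorem endName_eq_newVert_iff {x y v : V} (h : G.KeepAdj x y) (hv : G.IsStub v) :
    G.endName h = G.newVert hv ↔ ¬ G.Keep x ∧ y = v := by
  by_cases hx : G.Keep x
  · rw [endName_of_keep h hx]
    exact ⟨fun h' => absurd h'.symm (newVert_ne_keptVert _ _), fun h' => absurd hx h'.1⟩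
  · rw [endName_of_not_keep h hx, newVert_inj]
    simp [hx]

variable (G)

/-- The reduced graph: a stub is attached to a new vertex with a loop. -/
noncomputable def reduced : ConstraintGraph {x // G.IsName x} G.ReducedEdge where
  ends
    | .inl e =>
      -- An arbitrary orientation distinguishes the two ends; the unordered pair does not depend on
      -- it.
      let h := e.2.keepAdj (Orientation.nonempty G).some
      s(G.endName h, G.endName h.symm)
    | .inr v => s(G.newVert v.2, G.newVert v.2)
  weight
    | .inl e => G.weight e
    | .inr _ => 2
  weight_eq
    | .inl e => G.weight_eq e
    | .inr _ => .inr rfl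

end Reduced
end ConstraintGraph

namespace Orientation
open ConstraintGraph
variable {V E : Type} [DecidableEq V] [Fintype V] [Fintype E] {G : ConstraintGraph V E}

/-- The orientation of the reduced graph that stems from an orientation of the given graph. -/
noncomputable def reduce (A : Orientation G) : Orientation G.reduced where
  arc
    | .inl e => (G.endName (e.2.keepAdj A), G.endName (e.2.keepAdj A).symm)
    | .inr v => (G.newVert v.2, G.newVert v.2)
  arc_ends
    | .inl e => by
      obtain h | h := A.arc_eq_or (Orientation.nonempty G).some e
      · simp only [reduced, h]
      · simp only [reduced, h]
        exact Sym2.eq_swap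
    | .inr v => rfl

theorem reduce_reverse (A : Orientation G) : A.reverse.reduce = A.reduce.reverse := by
  ext1
  funext e
  rcases e with e | v <;> rfl

theorem Adj.reduce {A B : Orientation G} (h : A.Adj B) : A.reduce.Adj B.reduce := by
  rcases h with rfl | ⟨e, he, hf⟩
  · exact .inl rfl
  have key : ∀ f : {e // G.KeepEdge e}, f.1 ≠ e → B.reduce.arc (.inl f) = A.reduce.arc (.inl f) := by
    intro f hfe
    simp only [Orientation.reduce, hf f.1 hfe]
  by_cases hk : G.KeepEdge e
  · refine .inr ⟨.inl ⟨e, hk⟩, ?_, ?_⟩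
    · simp only [Orientation.reduce, he]
      rfl
    · rintro (f | v) hne
      · exact key f fun h => hne (congrArg Sum.inl (Subtype.ext h))
      · rfl
  -- The reversal of a deleted edge is invisible in the reduced graph; adjacency includes equality.
  · left
    ext1
    funext f
    rcases f with f | v
    · exact (key f fun h => hk (h ▸ f.2)).symm
    · rfl

theorem card_filter_reducedEdge (P : G.ReducedEdge → Prop) [DecidablePred P] :
    (Finset.univ.filter P).card = (Finset.univ.filter fun e => P (.inl e)).card +
      (Finset.univ.filter fun v => P (.inr v)).card := by
  simp only [Finset.card_filter, Fintype.sum_sum_type]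

theorem card_filter_keepEdge (P : E → Prop) [DecidablePred P] (hP : ∀ e, P e → G.KeepEdge e) :
    (Finset.univ.filter fun e : {e // G.KeepEdge e} => P e).card = (Finset.univ.filter P).card := by
  refine Finset.card_bij (fun e _ => e.1) ?_ (fun _ _ _ _ => Subtype.ext) ?_
  · intro e he; simpa using he
  · intro e he
    rw [Finset.mem_filter] at he
    exact ⟨⟨e, hP e he.2⟩, by simpa using he.2, rfl⟩

theorem inCount_reduce_keptVert (A : Orientation G) (w : ℕ) {v : V} (hv : G.Keep v) :
    A.reduce.inCount w (G.keptVert hv) = A.inCount w v := by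
  have h1 : ∀ e : {e // G.KeepEdge e}, (G.reduced.weight (.inl e) = w ∧
      (A.reduce.arc (.inl e)).2 = G.keptVert hv) ↔ G.weight e = w ∧ (A.arc e).2 = v := fun e =>
    and_congr_right fun _ => endName_eq_keptVert_iff (e.2.keepAdj A).symm hv
  have h2 : ∀ u : {v // G.IsStub v}, ¬ (G.reduced.weight (.inr u) = w ∧
      (A.reduce.arc (.inr u)).2 = G.keptVert hv) := fun u h =>
    newVert_ne_keptVert _ _ h.2
  have h3 := card_filter_keepEdge (G := G) (fun e => G.weight e = w ∧ (A.arc e).2 = v)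
    (fun e he => ⟨v, A.mem_ends.2 (.inr he.2.symm), hv⟩)
  have h4 := card_filter_reducedEdge fun e => G.reduced.weight e = w ∧
    (A.reduce.arc e).2 = G.keptVert hv
  simp only [h1, h2, Finset.filter_false, Finset.card_empty, add_zero] at h4
  unfold inCount
  convert h4
  convert h3.symm

theorem inCount_reduce_newVert (A : Orientation G) (w : ℕ) {v : V} (hv : G.IsStub v) :
    A.reduce.inCount w (G.newVert hv) =
      (Finset.univ.filter fun e => G.weight e = w ∧ ¬ G.Keep (A.arc e).2 ∧ (A.arc e).1 = v).card +
        if w = 2 then 1 else 0 := by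
  have h1 : ∀ e : {e // G.KeepEdge e}, (G.reduced.weight (.inl e) = w ∧
      (A.reduce.arc (.inl e)).2 = G.newVert hv) ↔
      G.weight e = w ∧ ¬ G.Keep (A.arc e).2 ∧ (A.arc e).1 = v := fun e =>
    and_congr_right fun _ => endName_eq_newVert_iff (e.2.keepAdj A).symm hv
  have h2 : ∀ u : {v // G.IsStub v}, (G.reduced.weight (.inr u) = w ∧
      (A.reduce.arc (.inr u)).2 = G.newVert hv) ↔ u = ⟨v, hv⟩ ∧ w = 2 := fun u =>
    and_comm.trans (and_congr ((newVert_inj u.2 hv).trans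
      ⟨fun h => Subtype.ext h, congrArg Subtype.val⟩) eq_comm)
  have h3 := card_filter_keepEdge (G := G)
    (fun e => G.weight e = w ∧ ¬ G.Keep (A.arc e).2 ∧ (A.arc e).1 = v)
    (fun e he => ⟨v, A.mem_ends.2 (.inl he.2.2.symm), hv.1⟩)
  have h4 := card_filter_reducedEdge fun e => G.reduced.weight e = w ∧
    (A.reduce.arc e).2 = G.newVert hv
  simp only [h1, h2] at h4
  have h5 : (Finset.univ.filter fun u : {v // G.IsStub v} => u = ⟨v, hv⟩ ∧ w = 2).card =
      if w = 2 then 1 else 0 := by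
    split <;> simp [*, Finset.filter_eq']
  rw [h5] at h4
  unfold inCount
  convert h4
  convert h3.symm

end Orientation

namespace ConstraintGraph
open NCL.Orientation
variable {V E : Type} [DecidableEq V] [Fintype V] [Fintype E] {G : ConstraintGraph V E}

/-- A deleted vertex is an OR vertex of a free component, so all its edges are blue and free. -/
theorem IsAndOr.keep_of_not_isFreeEdge (hG : G.IsAndOr) {e : E} (he : ¬ G.IsFreeEdge e) {v : V}
    (hv : v ∈ G.ends e) : G.Keep v := by
  by_contra hk
  obtain ⟨A⟩ := Orientation.nonempty G
  rw [Keep, not_or, not_not] at hk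
  exact he (G.isFreeEdge_of_mem (A.weight_eq_two_of_isOr ((hG v).resolve_left hk.1) hv) hv hk.2)

theorem IsStub.isFree (hG : G.IsAndOr) {v : V} (hv : G.IsStub v) : G.IsFree v := by
  obtain ⟨-, u, hu, e, he⟩ := hv
  by_contra hf
  refine hu (hG.keep_of_not_isFreeEdge (e := e) (fun h => hf (h.2 v ?_)) ?_) <;> simp [he]

theorem IsStub.isAnd (hG : G.IsAndOr) {v : V} (hv : G.IsStub v) : G.IsAnd v :=
  hv.1.resolve_right (not_not.2 (hv.isFree hG))

theorem IsAndOr.reduced (hG : G.IsAndOr) : G.reduced.IsAndOr := by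
  obtain ⟨A⟩ := Orientation.nonempty G
  have hdeg : ∀ w {v} (hv : G.Keep v), G.reduced.degree w (G.keptVert hv) = G.degree w v := by
    intro w v hv
    rw [A.reduce.degree_eq_inCount, A.degree_eq_inCount, ← reduce_reverse, inCount_reduce_keptVert,
      inCount_reduce_keptVert]
  rintro ⟨⟨b, v⟩, hv⟩
  cases b
  · change G.Keep v at hv
    rcases hG v with h | h
    · exact .inl ⟨(hdeg 1 hv).trans h.1, (hdeg 2 hv).trans h.2⟩
    · exact .inr ⟨(hdeg 1 hv).trans h.1, (hdeg 2 hv).trans h.2⟩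
  · change G.IsStub v at hv
    have hblue : ∀ e u, u ∈ G.ends e → ¬ G.Keep u → G.weight e = 2 := by
      intro e u hu hk
      rw [Keep, not_or] at hk
      exact A.weight_eq_two_of_isOr ((hG u).resolve_left hk.1) hu
    have hand := hv.isAnd hG
    right
    suffices h : G.reduced.IsOr (G.newVert hv) from h
    refine ⟨?_, ?_⟩
    · have h1 : ∀ B : Orientation G, (Finset.univ.filter fun e => G.weight e = 1 ∧
          ¬ G.Keep (B.arc e).2 ∧ (B.arc e).1 = v).card = 0 := by
        intro B
        rw [Finset.card_eq_zero, Finset.filter_eq_empty_iff]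
        rintro e - ⟨hw, hk, -⟩
        have := hblue e _ (B.mem_ends.2 (.inr rfl)) hk
        omega
      rw [A.reduce.degree_eq_inCount, ← reduce_reverse, inCount_reduce_newVert,
        inCount_reduce_newVert, h1, h1]
      rfl
    · have h2 : ∀ B : Orientation G, (Finset.univ.filter fun e => G.weight e = 2 ∧
          ¬ G.Keep (B.arc e).2 ∧ (B.arc e).1 = v).card ≤ B.reverse.inCount 2 v := by
        intro B
        refine Finset.card_le_card fun e he => ?_
        simp only [Finset.mem_filter, Finset.mem_univ, true_and] at he ⊢
        exact ⟨he.1, he.2.2⟩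
      have h3 : 1 ≤ (Finset.univ.filter fun e => G.weight e = 2 ∧ ¬ G.Keep (A.arc e).2 ∧
            (A.arc e).1 = v).card + (Finset.univ.filter fun e => G.weight e = 2 ∧
            ¬ G.Keep (A.reverse.arc e).2 ∧ (A.reverse.arc e).1 = v).card := by
        obtain ⟨-, u, hu, e, he⟩ := hv
        have hw := hblue e u (by simp [he]) hu
        rw [← A.arc_ends e, Sym2.eq_iff] at he
        rcases he with ⟨h, h'⟩ | ⟨h, h'⟩
        · refine le_trans (Finset.card_pos.2 ⟨e, ?_⟩) (Nat.le_add_right _ _)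
          simp [hw, h, h', hu]
        · refine le_trans (Finset.card_pos.2 ⟨e, ?_⟩) (Nat.le_add_left _ _)
          simp only [Finset.mem_filter, Finset.mem_univ, true_and]
          exact ⟨hw, by rw [← h] at hu; exact hu, h'⟩
      have h4 := hand.2
      rw [A.degree_eq_inCount] at h4
      have h5 := h2 A
      have h6 := h2 A.reverse
      rw [show A.reverse.reverse = A from rfl] at h6
      rw [A.reduce.degree_eq_inCount, ← reduce_reverse, inCount_reduce_newVert,
        inCount_reduce_newVert, if_pos rfl]
      omega

end ConstraintGraph
end NCL
-- The reduced graph has the same answer.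
namespace NCL

namespace Orientation
open ConstraintGraph
variable {V E : Type} [DecidableEq V] [Fintype V] [Fintype E] {G : ConstraintGraph V E}

theorem ends_reduced (A : Orientation G) {e : E} (he : G.KeepEdge e)
    (hk : ∀ v ∈ G.ends e, G.Keep v) : G.reduced.ends (.inl ⟨e, he⟩) =
      s(G.keptVert (hk _ (A.mem_ends.2 (.inl rfl))), G.keptVert (hk _ (A.mem_ends.2 (.inr rfl)))) := by
  rw [← A.reduce.arc_ends]
  simp only [reduce]
  rw [endName_of_keep _ (hk _ (A.mem_ends.2 (.inl rfl))),
    endName_of_keep _ (hk _ (A.mem_ends.2 (.inr rfl)))]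

theorem feasible_reduce {A : Orientation G} (hA : A.Feasible) :
    A.reduce.Feasible := by
  classical
  rintro ⟨⟨b, v⟩, hv⟩
  rw [inWeight_eq]
  cases b
  · have h1 := A.inCount_reduce_keptVert 1 hv
    have h2 := A.inCount_reduce_keptVert 2 hv
    have := hA v
    rw [inWeight_eq, ← h1, ← h2] at this
    exact this
  -- The loop alone gives the new vertex weight two.
  · have h2 := A.inCount_reduce_newVert 2 hv
    have h3 : 1 ≤ A.reduce.inCount 2 (G.newVert hv) := by
      rw [h2, if_pos rfl]
      omega
    have h4 : 2 ≤ A.reduce.inCount 1 (G.newVert hv) + 2 * A.reduce.inCount 2 (G.newVert hv) := by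
      omega
    exact h4

/-- The orientation of the given graph that agrees with an orientation of the reduced graph outside
of free components and with `F` in free components. -/
noncomputable def lift (hG : G.IsAndOr) (F : Orientation G) (X : Orientation G.reduced) :
    Orientation G where
  arc e := if h : G.KeepEdge e ∧ ¬ G.IsFreeEdge e then
    ((X.arc (.inl ⟨e, h.1⟩)).1.1.2, (X.arc (.inl ⟨e, h.1⟩)).2.1.2) else F.arc e
  arc_ends e := by
    split
    · next h =>
      have h1 := congrArg (Sym2.map fun x => x.1.2) (X.arc_ends (.inl ⟨e, h.1⟩))
      rw [F.ends_reduced h.1 fun v => hG.keep_of_not_isFreeEdge h.2, Sym2.map_mk, Sym2.map_mk] at h1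
      exact h1.trans (F.arc_ends e)
    · exact F.arc_ends e

section
variable (hG : G.IsAndOr) (F : Orientation G)

theorem lift_arc_of_isFreeEdge (X : Orientation G.reduced) {e : E} (he : G.IsFreeEdge e) :
    (lift hG F X).arc e = F.arc e := dif_neg fun h => h.2 he

theorem keepEdge_of_not_isFreeEdge (hG : G.IsAndOr) {e : E} (he : ¬ G.IsFreeEdge e) :
    G.KeepEdge e := by
  obtain ⟨A⟩ := Orientation.nonempty G
  have h := A.mem_ends (e := e).2 (.inl rfl)
  exact ⟨_, h, hG.keep_of_not_isFreeEdge he h⟩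

theorem lift_arc (X : Orientation G.reduced) {e : E} (he : ¬ G.IsFreeEdge e) :
    (lift hG F X).arc e = ((X.arc (.inl ⟨e, keepEdge_of_not_isFreeEdge hG he⟩)).1.1.2,
      (X.arc (.inl ⟨e, keepEdge_of_not_isFreeEdge hG he⟩)).2.1.2) :=
  dif_pos ⟨keepEdge_of_not_isFreeEdge hG he, he⟩

theorem Adj.lift {X Y : Orientation G.reduced} (h : X.Adj Y) :
    (lift hG F X).Adj (lift hG F Y) := by
  rcases h with rfl | ⟨e, he, hf⟩
  · exact .inl rfl
  have key : ∀ f, (∀ h : G.KeepEdge f, G.IsFreeEdge f ∨ .inl ⟨f, h⟩ ≠ e) →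
      (Orientation.lift hG F Y).arc f = (Orientation.lift hG F X).arc f := by
    intro f hfe
    by_cases hfree : G.IsFreeEdge f
    · rw [lift_arc_of_isFreeEdge _ _ _ hfree, lift_arc_of_isFreeEdge _ _ _ hfree]
    · rw [lift_arc _ _ _ hfree, lift_arc _ _ _ hfree, hf _ ((hfe _).resolve_left hfree)]
  by_cases hex : ∃ f : E, ¬ G.IsFreeEdge f ∧ ∃ h, .inl ⟨f, h⟩ = e
  · obtain ⟨f, hfree, h, rfl⟩ := hex
    refine .inr ⟨f, ?_, fun g hg => key g fun h' => .inr fun h'' => hg ?_⟩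
    · rw [lift_arc _ _ _ hfree, lift_arc _ _ _ hfree, he]
      rfl
    · exact congrArg Subtype.val (Sum.inl.inj h'')
  -- The reversed arc belongs to a free edge or to an added loop, and the lift ignores both.
  · push Not at hex
    left
    ext1
    funext f
    refine (key f fun h => ?_).symm
    by_cases hfree : G.IsFreeEdge f
    · exact .inl hfree
    · exact .inr (hex f hfree h)

theorem blueIn_le_lift (X : Orientation G.reduced) {v : V} (hv : G.IsFree v) :
    F.blueIn v ≤ (lift hG F X).blueIn v :=
  blueIn_mono fun e he hev => by
    rwa [lift_arc_of_isFreeEdge]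
    exact G.isFreeEdge_of_mem he (F.mem_ends.2 (.inr hev.symm)) hv

theorem inCount_le_lift (X : Orientation G.reduced) (w : ℕ) {v : V} (hv : ¬ G.IsFree v) :
    X.inCount w (G.keptVert (.inr hv)) ≤ (lift hG F X).inCount w v := by
  have h1 : ∀ u : {v // G.IsStub v}, ¬ (G.reduced.weight (.inr u) = w ∧
      (X.arc (.inr u)).2 = G.keptVert (.inr hv)) := by
    rintro u ⟨-, h⟩
    have h2 : (X.arc (.inr u)).2 ∈ G.reduced.ends (.inr u) := X.mem_ends.2 (.inr rfl)
    rw [h, reduced, Sym2.mem_iff, or_self] at h2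
    exact newVert_ne_keptVert _ _ h2.symm
  rw [inCount, card_filter_reducedEdge]
  simp only [h1, Finset.filter_false, Finset.card_empty, add_zero]
  refine Finset.card_le_card_of_injOn (fun e => e.1) ?_ (fun _ _ _ _ => Subtype.ext)
  intro e he
  simp only [Finset.coe_filter, Finset.mem_univ, true_and, Set.mem_ofPred_eq] at he ⊢
  obtain ⟨hw, he⟩ := he
  refine ⟨hw, ?_⟩
  -- A free edge has no end at the non-free vertex `v`, so the lift copies this arc from `X`.
  have hfree : ¬ G.IsFreeEdge e.1 := by
    intro hf
    have h2 : (X.arc (.inl e)).2 ∈ G.reduced.ends (.inl e) := X.mem_ends.2 (.inr rfl)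
    rw [he, F.reduce.mem_ends] at h2
    have h3 := e.2.keepAdj F
    rcases h2 with h2 | h2
    · exact hv (hf.2 v (F.mem_ends.2 (.inl ((endName_eq_keptVert_iff h3 _).1 h2.symm).symm)))
    · exact hv (hf.2 v (F.mem_ends.2 (.inr ((endName_eq_keptVert_iff h3.symm _).1 h2.symm).symm)))
  rw [lift_arc _ _ _ hfree]
  exact congrArg (fun x => x.1.2) he

theorem feasible_lift (hF : ∀ v, G.IsFree v → 1 ≤ F.blueIn v) {X : Orientation G.reduced}
    (hX : X.Feasible) : (lift hG F X).Feasible := by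
  intro v
  by_cases hv : G.IsFree v
  · exact two_le_inWeight ((hF v hv).trans (blueIn_le_lift hG F X hv))
  · have h := hX (G.keptVert (.inr hv))
    have h1 := inCount_le_lift hG F X 1 hv
    have h2 := inCount_le_lift hG F X 2 hv
    rw [inWeight_eq] at h ⊢
    omega

theorem agreeOff_lift_reduce (A : Orientation G) : A.AgreeOff (lift hG F A.reduce) := by
  intro e he
  rw [lift_arc _ _ _ he]
  simp only [reduce]
  rw [endName_of_keep _ (hG.keep_of_not_isFreeEdge he (A.mem_ends.2 (.inl rfl))),
    endName_of_keep _ (hG.keep_of_not_isFreeEdge he (A.mem_ends.2 (.inr rfl)))]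
  rfl

end

/-- The reduced graph gives the same answers. -/
theorem reach_iff_reach_reduce (hG : G.IsAndOr) {A B : Orientation G} (hA : A.Feasible)
    (hB : B.Feasible) : Reach A B ↔ Reach A.reduce B.reduce := by
  constructor
  · intro h
    induction h with
    | refl => exact .refl
    | tail _ hb ih =>
      exact .tail (ih hb.1) ⟨feasible_reduce hb.1, feasible_reduce hb.2.1, hb.2.2.reduce⟩
  -- One filling `F` serves the whole sequence; the two ends are then joined to their lifts by
  -- reconfiguration inside free components.
  · obtain ⟨F, -, hF⟩ := A.exists_agreeOff
    have hlift : ∀ {X Y : Orientation G.reduced}, Reach X Y → Reach (lift hG F X) (lift hG F Y) := by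
      intro X Y h
      induction h with
      | refl => exact .refl
      | tail _ hb ih =>
        exact .tail ih ⟨feasible_lift hG F hF hb.1, feasible_lift hG F hF hb.2.1,
          hb.2.2.lift hG F⟩
    have hred : ∀ {A : Orientation G}, A.Feasible → Reach A (lift hG F A.reduce) := fun {A} hA =>
      (agreeOff_lift_reduce hG F A).reach hA fun v hv =>
        (hF v hv).trans (blueIn_le_lift hG F _ hv)
    exact fun h => (hred hA).trans ((hlift h).trans (hred hB).symm)

end Orientation

/-! ### The number of vertices of the reduced graph. -/

namespace ConstraintGraph
variable {V E : Type} [DecidableEq V] [Fintype V] [Fintype E] {G : ConstraintGraph V E}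

/-- Twice the number of blue edges of the component is `a + 3 * o`, and at most `2 * (a + o)`
because the component is not free. -/
theorem IsAndOr.card_isOr_le_of_not_isFree (hG : G.IsAndOr) {u : V} (hu : ¬ G.IsFree u) :
    ((G.blueComp u).filter G.IsOr).card ≤ ((G.blueComp u).filter G.IsAnd).card := by
  obtain ⟨A⟩ := Orientation.nonempty G
  have h1 := sum_degree A 2 (G.blueComp u) fun e he => A.mem_blueComp_iff he u
  rw [A.isFree_iff, not_lt] at hu
  have h2 : (G.blueComp u).card =
      ((G.blueComp u).filter G.IsAnd).card + ((G.blueComp u).filter G.IsOr).card := by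
    rw [← Finset.card_filter_add_card_filter_not (s := G.blueComp u) (fun v => G.IsAnd v)]
    congr 2
    · exact Finset.filter_congr fun v _ => ⟨(hG v).resolve_left, fun h h' => G.not_isOr_of_isAnd h' h⟩
  have h3 : ∑ v ∈ G.blueComp u, G.degree 2 v =
      ((G.blueComp u).filter G.IsAnd).card + 3 * ((G.blueComp u).filter G.IsOr).card := by
    rw [Finset.card_filter, Finset.card_filter, Finset.mul_sum, ← Finset.sum_add_distrib]
    refine Finset.sum_congr rfl fun v _ => ?_
    rcases hG v with h | h
    · rw [if_pos h, if_neg (G.not_isOr_of_isAnd h), h.2, mul_zero, add_zero]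
    · rw [if_neg fun h' => G.not_isOr_of_isAnd h' h, if_pos h, h.2, mul_one, zero_add]
  omega

theorem IsAndOr.card_not_isFree_isOr_le (hG : G.IsAndOr) :
    (Finset.univ.filter fun v => ¬ G.IsFree v ∧ G.IsOr v).card ≤
      (Finset.univ.filter fun v => ¬ G.IsFree v ∧ G.IsAnd v).card := by
  have hfib : ∀ (p : V → Prop) [DecidablePred p], (Finset.univ.filter fun v => ¬ G.IsFree v ∧ p v).card =
      ∑ K : Finset V, (Finset.univ.filter fun v => (¬ G.IsFree v ∧ p v) ∧ G.blueComp v = K).card := by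
    intro p _
    rw [sum_card_fiber Finset.univ (fun v => ¬ G.IsFree v ∧ p v) G.blueComp]
    simp
  rw [hfib, hfib G.IsAnd]
  refine Finset.sum_le_sum fun K _ => ?_
  by_cases hK : ∃ u, ¬ G.IsFree u ∧ G.blueComp u = K
  · obtain ⟨u, hu, rfl⟩ := hK
    have h : ∀ (p : V → Prop) [DecidablePred p], (Finset.univ.filter fun v => (¬ G.IsFree v ∧ p v) ∧
        G.blueComp v = G.blueComp u) = (G.blueComp u).filter p := by
      intro p _
      ext v
      simp only [Finset.mem_filter, Finset.mem_univ, true_and]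
      constructor
      · rintro ⟨⟨-, h⟩, h'⟩
        exact ⟨h' ▸ G.self_mem_blueComp v, h⟩
      · rintro ⟨h, h'⟩
        have h := G.mem_blueComp.1 h
        exact ⟨⟨fun hv => hu (h.isFree_iff.2 hv), h'⟩, h.blueComp_eq.symm⟩
    rw [h, h]
    exact hG.card_isOr_le_of_not_isFree hu
  · rw [Finset.filter_eq_empty_iff.2]
    · simp
    · rintro v - ⟨⟨h, -⟩, h'⟩
      exact hK ⟨v, h, h'⟩

/-- The non-free OR vertices are paid for by the non-free AND vertices, and the new vertices by the
free AND vertices, so each AND vertex pays for itself and at most one more on average. -/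
theorem IsAndOr.card_isName_le (hG : G.IsAndOr) :
    Fintype.card {x // G.IsName x} ≤ 2 * G.numAnd := by
  have h1 : (Finset.univ.filter G.IsName) ⊆ (Finset.univ.filter G.Keep).image (Prod.mk false) ∪
      (Finset.univ.filter G.IsStub).image (Prod.mk true) := by
    rintro ⟨b, v⟩ hv
    have hv := (Finset.mem_filter.1 hv).2
    cases b
    · have hv : G.Keep v := hv
      simp [hv]
    · have hv : G.IsStub v := hv
      simp [hv]
  have h2 : (Finset.univ.filter G.Keep) ⊆ (Finset.univ.filter G.IsAnd) ∪
      (Finset.univ.filter fun v => ¬ G.IsFree v ∧ G.IsOr v) := by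
    intro v hv
    have hv : G.Keep v := (Finset.mem_filter.1 hv).2
    rcases hG v with h | h
    · simp [h]
    · simp [h, hv.resolve_left fun h' => G.not_isOr_of_isAnd h' h]
  have h3 : (Finset.univ.filter G.IsStub) ⊆ Finset.univ.filter fun v => G.IsAnd v ∧ G.IsFree v := by
    intro v hv
    have hv : G.IsStub v := (Finset.mem_filter.1 hv).2
    simp [hv.isFree hG, hv.isAnd hG]
  have h4 := (Finset.card_le_card h1).trans (Finset.card_union_le _ _)
  have h5 := (Finset.card_le_card h2).trans (Finset.card_union_le _ _)
  have h6 := Finset.card_le_card h3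
  have h7 := hG.card_not_isFree_isOr_le
  have h8 : G.numAnd = (Finset.univ.filter fun v => G.IsAnd v ∧ G.IsFree v).card +
      (Finset.univ.filter fun v => ¬ G.IsFree v ∧ G.IsAnd v).card := by
    rw [numAnd, ← Finset.card_filter_add_card_filter_not
      (s := Finset.univ.filter fun v => G.IsAnd v) (fun v => G.IsFree v),
      Finset.filter_filter, Finset.filter_filter]
    simp only [and_comm]
  have h9 : G.numAnd = (Finset.univ.filter G.IsAnd).card := rfl
  rw [Finset.card_image_of_injective _ (Prod.mk_right_injective _),
    Finset.card_image_of_injective _ (Prod.mk_right_injective _)] at h4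
  have h10 : (Finset.univ.filter G.IsName).card ≤ 2 * G.numAnd := by omega
  rw [Fintype.card_subtype]
  exact h10

end ConstraintGraph
end NCL
namespace NCL

/-! ## Renaming of vertices and edges -/

/-- The constraint graph with renamed vertices and edges. -/
def ConstraintGraph.relabel {V E V' E' : Type} (G : ConstraintGraph V E) (σ : V ≃ V')
    (τ : E' ≃ E) : ConstraintGraph V' E' where
  ends e := (G.ends (τ e)).map σ
  weight e := G.weight (τ e)
  weight_eq e := G.weight_eq (τ e)

namespace Orientation

section
variable {V E V' E' : Type} {G : ConstraintGraph V E} (σ : V ≃ V') (τ : E' ≃ E)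

/-- The orientation after renaming. -/
def relabel (A : Orientation G) : Orientation (G.relabel σ τ) where
  arc e := (A.arc (τ e)).map σ σ
  arc_ends e := congrArg (Sym2.map σ) (A.arc_ends (τ e))

/-- The orientation before renaming. -/
def unrelabel (A : Orientation (G.relabel σ τ)) : Orientation G where
  arc e := (A.arc (τ.symm e)).map σ.symm σ.symm
  arc_ends e := by
    refine (congrArg (Sym2.map σ.symm) (A.arc_ends (τ.symm e))).trans ?_
    simp [ConstraintGraph.relabel, Sym2.map_map]

theorem relabel_unrelabel (A : Orientation (G.relabel σ τ)) :
    (A.unrelabel σ τ).relabel σ τ = A := by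
  ext e <;> simp [relabel, unrelabel]

theorem unrelabel_relabel (A : Orientation G) : (A.relabel σ τ).unrelabel σ τ = A := by
  ext e <;> simp [relabel, unrelabel]

theorem Adj.relabel {A B : Orientation G} (h : A.Adj B) :
    (A.relabel σ τ).Adj (B.relabel σ τ) := by
  rcases h with rfl | ⟨e, he, hf⟩
  · exact .inl rfl
  · refine .inr ⟨τ.symm e, ?_, fun f hfe => ?_⟩
    · simp only [Orientation.relabel, Equiv.apply_symm_apply, he]
      rfl
    · simp only [Orientation.relabel]
      rw [hf]
      rintro rfl
      simp at hfe

theorem Adj.unrelabel {A B : Orientation (G.relabel σ τ)} (h : A.Adj B) :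
    (A.unrelabel σ τ).Adj (B.unrelabel σ τ) := by
  rcases h with rfl | ⟨e, he, hf⟩
  · exact .inl rfl
  · refine .inr ⟨τ e, ?_, fun f hfe => ?_⟩
    · simp only [Orientation.unrelabel, Equiv.symm_apply_apply, he]
      rfl
    · simp only [Orientation.unrelabel]
      rw [hf]
      rintro rfl
      simp at hfe

end

variable {V E V' E' : Type} [DecidableEq V] [Fintype E] [DecidableEq V'] [Fintype E']
  {G : ConstraintGraph V E} (σ : V ≃ V') (τ : E' ≃ E)

theorem inCount_relabel (A : Orientation G) (w : ℕ) (v : V) :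
    (A.relabel σ τ).inCount w (σ v) = A.inCount w v := by
  refine Finset.card_equiv τ fun e => ?_
  simp [relabel, ConstraintGraph.relabel]

theorem degree_relabel (w : ℕ) (v : V) : (G.relabel σ τ).degree w (σ v) = G.degree w v := by
  obtain ⟨A⟩ := Orientation.nonempty G
  rw [(A.relabel σ τ).degree_eq_inCount, A.degree_eq_inCount, inCount_relabel,
    ← inCount_relabel σ τ A.reverse]
  rfl

theorem feasible_relabel (A : Orientation G) : (A.relabel σ τ).Feasible ↔ A.Feasible := by
  refine (Equiv.forall_congr σ fun v => ?_).symm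
  rw [inWeight_eq, inWeight_eq, inCount_relabel, inCount_relabel]

theorem feasible_unrelabel {A : Orientation (G.relabel σ τ)} (hA : A.Feasible) :
    (A.unrelabel σ τ).Feasible := by
  rwa [← feasible_relabel σ τ, relabel_unrelabel]

theorem reach_relabel (A B : Orientation G) :
    Reach (A.relabel σ τ) (B.relabel σ τ) ↔ Reach A B := by
  constructor
  · have key : ∀ {X Y : Orientation (G.relabel σ τ)}, Reach X Y →
        Reach (X.unrelabel σ τ) (Y.unrelabel σ τ) := by
      intro X Y h
      induction h with
      | refl => exact .refl
      | tail _ hb ih =>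
        exact .tail ih ⟨feasible_unrelabel σ τ hb.1, feasible_unrelabel σ τ hb.2.1,
          hb.2.2.unrelabel σ τ⟩
    intro h
    simpa only [unrelabel_relabel] using key h
  · intro h
    induction h with
    | refl => exact .refl
    | tail _ hb ih =>
      exact .tail ih ⟨(feasible_relabel σ τ _).2 hb.1, (feasible_relabel σ τ _).2 hb.2.1,
        hb.2.2.relabel σ τ⟩

end Orientation

theorem ConstraintGraph.IsAndOr.relabel {V E V' E' : Type} [DecidableEq V] [Fintype E]
    [DecidableEq V'] [Fintype E'] {G : ConstraintGraph V E} (hG : G.IsAndOr) (σ : V ≃ V')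
    (τ : E' ≃ E) : (G.relabel σ τ).IsAndOr := by
  refine (Equiv.forall_congr σ fun v => ?_).1 hG
  rw [IsAnd, IsAnd, IsOr, IsOr, Orientation.degree_relabel, Orientation.degree_relabel]

end NCL
namespace NCL
open Enc (enc)

/-! ## Correctness of the algorithm -/

/-- An inflationary map on finite sets reaches a fixed point after as many steps as there are
elements. -/
theorem iterate_card_fixed {α : Type} [Fintype α] [DecidableEq α] (f : Finset α → Finset α)
    (hf : ∀ s, s ⊆ f s) (s : Finset α) :
    f (f^[Fintype.card α] s) = f^[Fintype.card α] s := by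
  by_cases h : ∃ k ≤ Fintype.card α, f (f^[k] s) = f^[k] s
  · obtain ⟨k, hk, hfix⟩ := h
    have : f^[Fintype.card α] s = f^[k] s := by
      obtain ⟨d, hd⟩ := Nat.exists_eq_add_of_le' hk
      rw [hd, Function.iterate_add_apply, Function.iterate_fixed hfix]
    rw [this, hfix]
  · push Not at h
    have hcard : ∀ k ≤ Fintype.card α + 1, k ≤ (f^[k] s).card := by
      intro k
      induction k with
      | zero => simp
      | succ k ih =>
        intro hk
        rw [Function.iterate_succ_apply']
        have h1 := Finset.card_lt_card ((hf (f^[k] s)).ssubset_of_ne (h k (by omega)).symm)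
        have h2 := ih (by omega)
        omega
    have h1 := hcard _ le_rfl
    have h2 := Finset.card_le_univ (f^[Fintype.card α + 1] s)
    omega

theorem length_filter_finRange {m : ℕ} (p : Fin m → Bool) :
    ((List.finRange m).filter p).length = (Finset.univ.filter fun i => p i = true).card := by
  rw [← List.toFinset_card_of_nodup ((List.nodup_finRange m).filter _)]
  congr 1
  ext i
  simp

namespace C2CInstance
variable (I : C2CInstance)

/-- The input of the algorithm for one edge. -/
def edgeCode (e : Fin I.m) : EdgeCode :=
  (I.graph.weight e, (I.ini.arc e).1, (I.ini.arc e).2, (I.tar.arc e).1, (I.tar.arc e).2, ())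

/-- The input of the algorithm. -/
def code : Code := (I.n, (List.finRange I.m).map I.edgeCode)

theorem encode_eq : I.encode = enc I.code := by
  have h : enc I.code = .cons (Data.ofNat I.n)
    (Data.ofList (((List.finRange I.m).map I.edgeCode).map enc)) := rfl
  rw [h, encode, List.ofFn_eq_map, List.map_map]
  rfl

/-- Vertex numbers are written in unary, so the encoding is quadratic in the size; hence time
polynomial in the one is polynomial in the other. -/
theorem esize_code_le : esize I.code ≤ (8 * I.size + 23) * I.size + 3 := by
  have h1 : ∀ e, esize (I.edgeCode e) ≤ 8 * I.n + 20 := by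
    intro e
    have h0 := I.graph.weight_eq e
    have h1 := (I.ini.arc e).1.isLt
    have h2 := (I.ini.arc e).2.isLt
    have h3 := (I.tar.arc e).1.isLt
    have h4 := (I.tar.arc e).2.isLt
    have h5 : esize () = 1 := rfl
    simp only [edgeCode, esize_prod, esize_nat, h5]
    omega
  have h2 : ∀ l : List (Fin I.m), esize (l.map I.edgeCode) ≤ l.length * (8 * I.n + 21) + 1 := by
    intro l
    induction l with
    | nil => simp
    | cons e l ih =>
      have := h1 e
      simp only [List.map_cons, esize_cons, List.length_cons]
      nlinarith
  have h3 := h2 (List.finRange I.m)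
  rw [List.length_finRange] at h3
  simp only [code, esize_prod, esize_nat, size] at h3 ⊢
  nlinarith [Nat.zero_le (I.n * I.n), Nat.zero_le (I.m * I.m), Nat.zero_le (I.n * I.m)]

end C2CInstance

namespace Code
open C2CInstance
variable (I : C2CInstance)

theorem elem_iff {u : ℕ} {C : List ℕ} : elem u C = true ↔ u ∈ C := by
  simp [elem]

theorem any_edges (p : EdgeCode → Bool) :
    I.code.2.any p = true ↔ ∃ e, p (I.edgeCode e) = true := by
  simp [code]

/-- The vertices that occur in a list. -/
def verts (C : List ℕ) : Finset (Fin I.n) := Finset.univ.filter fun v => v.1 ∈ C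

open Classical in
/-- The vertices that are in `S` or have a blue neighbour in `S`. -/
noncomputable def expandSet (S : Finset (Fin I.n)) : Finset (Fin I.n) :=
  Finset.univ.filter fun u => u ∈ S ∨ ∃ v ∈ S, I.graph.BlueAdj u v

theorem mem_verts {C : List ℕ} {v : Fin I.n} : v ∈ verts I C ↔ v.1 ∈ C := by
  simp [verts]

theorem mem_expandSet {S : Finset (Fin I.n)} {u : Fin I.n} :
    u ∈ expandSet I S ↔ u ∈ S ∨ ∃ v ∈ S, I.graph.BlueAdj u v := by
  simp [expandSet]

theorem verts_expand (C : List ℕ) : verts I (expand I.code C) = expandSet I (verts I C) := by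
  ext u
  have h : u.1 < I.code.1 := u.isLt
  rw [mem_verts, mem_expandSet, mem_verts, expand, List.mem_filter, List.mem_range,
    and_iff_right h, Bool.or_eq_true, elem_iff, any_edges]
  refine or_congr_right ?_
  simp only [Bool.and_eq_true, Bool.or_eq_true, decide_eq_true_eq, elem_iff, mem_verts]
  constructor
  · rintro ⟨e, hw, ⟨h1, h2⟩ | ⟨h1, h2⟩⟩
    · obtain rfl : (I.ini.arc e).1 = u := Fin.ext h1
      exact ⟨_, h2, e, hw, (I.ini.arc_ends e).symm⟩
    · obtain rfl : (I.ini.arc e).2 = u := Fin.ext h1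
      exact ⟨_, h2, e, hw, (I.ini.arc_ends e).symm.trans Sym2.eq_swap⟩
  · rintro ⟨v, hv, e, hw, he⟩
    rw [← I.ini.arc_ends e, Sym2.eq_iff] at he
    rcases he with ⟨rfl, rfl⟩ | ⟨rfl, rfl⟩
    · exact ⟨e, hw, .inl ⟨rfl, hv⟩⟩
    · exact ⟨e, hw, .inr ⟨rfl, hv⟩⟩

/-- All iterates stay inside the component. After `I.n` steps a fixed point of `expandSet` is
reached, which is closed under blue adjacency and thus exhausts the component. -/
theorem verts_comp (v : Fin I.n) : verts I (comp I.code v) = I.graph.blueComp v := by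
  have h1 : verts I (comp I.code v) = (expandSet I)^[I.n] {v} := by
    have h : ∀ k, verts I ((expand I.code)^[k] [v.1]) = (expandSet I)^[k] {v} := by
      intro k
      induction k with
      | zero => ext u; simp [verts, Fin.val_inj]
      | succ k ih => rw [Function.iterate_succ_apply', Function.iterate_succ_apply',
          verts_expand, ih]
    exact h I.n
  have hsub : ∀ S, S ⊆ expandSet I S := fun S u hu => (mem_expandSet I).2 (.inl hu)
  have hfix := iterate_card_fixed (expandSet I) hsub {v}
  rw [Fintype.card_fin] at hfix
  have hconn : ∀ k, ∀ u ∈ (expandSet I)^[k] {v}, I.graph.BlueConn v u := by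
    intro k
    induction k with
    | zero =>
      intro u hu
      rw [Function.iterate_zero, id, Finset.mem_singleton] at hu
      exact hu ▸ .refl
    | succ k ih =>
      intro u hu
      rw [Function.iterate_succ_apply', mem_expandSet] at hu
      obtain hu | ⟨x, hx, hux⟩ := hu
      · exact ih u hu
      · exact (ih x hx).tail (hux.symm I.graph)
  have hv : ∀ k, v ∈ (expandSet I)^[k] {v} := by
    intro k
    induction k with
    | zero => simp
    | succ k ih => rw [Function.iterate_succ_apply']; exact hsub _ ih
  rw [h1]
  ext u
  rw [I.graph.mem_blueComp]
  refine ⟨hconn _ u, fun h => ?_⟩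
  induction h with
  | refl => exact hv _
  | @tail b c _ hbc ih =>
    rw [← hfix, mem_expandSet]
    exact .inr ⟨b, ih, hbc.symm I.graph⟩

theorem mem_comp (v u : Fin I.n) : u.1 ∈ comp I.code v ↔ u ∈ I.graph.blueComp v := by
  rw [← verts_comp]
  simp [verts]

theorem length_comp (v : Fin I.n) : (comp I.code v).length = (I.graph.blueComp v).card := by
  -- At least one step is made, so the list is a filtered `List.range` and has no repetitions.
  obtain ⟨k, hk⟩ : ∃ k, I.n = k + 1 := ⟨I.n - 1, by have := v.isLt; omega⟩
  have h : ∃ C, comp I.code v = expand I.code C := by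
    refine ⟨(expand I.code)^[k] [v.1], ?_⟩
    have h : I.code.1 = k + 1 := hk
    rw [comp, h, Function.iterate_succ_apply']
  obtain ⟨C, hC⟩ := h
  have hnd : (comp I.code v).Nodup := hC ▸ (List.nodup_range).filter _
  rw [← List.toFinset_card_of_nodup hnd, ← Finset.card_map Fin.valEmbedding]
  congr 1
  ext u
  simp only [List.mem_toFinset, Finset.mem_map, Fin.valEmbedding_apply]
  constructor
  · intro hu
    have hu' : u < I.n := by
      rw [hC, expand, List.mem_filter, List.mem_range] at hu
      exact hu.1
    exact ⟨⟨u, hu'⟩, (mem_comp I v ⟨u, hu'⟩).1 hu, rfl⟩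
  · rintro ⟨u, hu, rfl⟩
    exact (mem_comp I v u).2 hu

theorem free_iff (v : Fin I.n) : free I.code v = true ↔ I.graph.IsFree v := by
  rw [free, decide_eq_true_eq, length_comp, I.ini.isFree_iff]
  have h : (I.code.2.filter fun e => decide (e.w = 2) && elem e.a (comp I.code v)).length =
      (Finset.univ.filter fun e => I.graph.weight e = 2 ∧
        (I.ini.arc e).1 ∈ I.graph.blueComp v).card := by
    rw [code, List.filter_map, List.length_map, length_filter_finRange]
    congr 1
    refine Finset.filter_congr fun e _ => ?_
    rw [← mem_comp, ← elem_iff, Function.comp_apply, Bool.and_eq_true, decide_eq_true_eq]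
    rfl
  rw [h]

/-- In an AND/OR graph the AND vertices are exactly those incident with a red edge, which is what
the algorithm tests. -/
theorem keep_iff (hI : I.graph.IsAndOr) (v : Fin I.n) :
    keep I.code v = true ↔ I.graph.Keep v := by
  rw [keep, Bool.or_eq_true, any_edges, Bool.not_eq_true', ← Bool.not_eq_true, free_iff,
    ConstraintGraph.Keep]
  refine or_congr_left ?_
  simp only [Bool.and_eq_true, Bool.or_eq_true, decide_eq_true_eq]
  have hends : ∀ e, (I.edgeCode e).a = v ∨ (I.edgeCode e).b = v ↔ v ∈ I.graph.ends e := fun e => by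
    rw [I.ini.mem_ends, Fin.ext_iff, Fin.ext_iff]
    exact or_congr eq_comm eq_comm
  simp only [hends]
  constructor
  · rintro ⟨e, hw, he⟩
    refine (hI v).resolve_right fun h => ?_
    have h1 := I.ini.weight_eq_two_of_isOr h he
    have h2 : I.graph.weight e = 1 := hw
    omega
  · intro h
    have h1 := h.1
    rw [I.graph.degree_eq I.ini] at h1
    by_contra! hcon
    rw [Finset.card_eq_zero.2, Finset.card_eq_zero.2] at h1
    · omega
    · rw [Finset.filter_eq_empty_iff]
      exact fun e _ he => hcon e he.1 (I.ini.mem_ends.2 (.inr he.2.symm))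
    · rw [Finset.filter_eq_empty_iff]
      exact fun e _ he => hcon e he.1 (I.ini.mem_ends.2 (.inl he.2.symm))

theorem stub_iff (hI : I.graph.IsAndOr) (v : Fin I.n) :
    stub I.code v = true ↔ I.graph.IsStub v := by
  rw [stub, Bool.and_eq_true, keep_iff I hI, any_edges, ConstraintGraph.IsStub]
  refine and_congr_right fun _ => ?_
  have ha : ∀ e, keep I.code (I.edgeCode e).a = true ↔ I.graph.Keep (I.ini.arc e).1 :=
    fun e => keep_iff I hI _
  have hb : ∀ e, keep I.code (I.edgeCode e).b = true ↔ I.graph.Keep (I.ini.arc e).2 :=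
    fun e => keep_iff I hI _
  simp only [Bool.and_eq_true, Bool.or_eq_true, decide_eq_true_eq, Bool.not_eq_true',
    ← Bool.not_eq_true, ha, hb]
  constructor
  · rintro ⟨e, ⟨h1, h2⟩ | ⟨h1, h2⟩⟩
    · obtain rfl : (I.ini.arc e).1 = v := Fin.ext h1
      exact ⟨_, h2, e, (I.ini.arc_ends e).symm⟩
    · obtain rfl : (I.ini.arc e).2 = v := Fin.ext h1
      exact ⟨_, h2, e, (I.ini.arc_ends e).symm.trans Sym2.eq_swap⟩
  · rintro ⟨u, hu, e, he⟩
    rw [← I.ini.arc_ends e, Sym2.eq_iff] at he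
    rcases he with ⟨rfl, rfl⟩ | ⟨rfl, rfl⟩
    · exact ⟨e, .inl ⟨rfl, hu⟩⟩
    · exact ⟨e, .inr ⟨rfl, hu⟩⟩

/-- The name of a vertex of the reduced graph in the algorithm. -/
def name {n : ℕ} (x : Bool × Fin n) : Bool × ℕ := (x.1, x.2)

theorem name_injective {n : ℕ} : Function.Injective (name (n := n)) := by
  rintro ⟨a, u⟩ ⟨b, v⟩ h
  simpa [name, Fin.val_inj] using h

theorem mem_names (hI : I.graph.IsAndOr) (x : Bool × ℕ) :
    x ∈ names I.code ↔ ∃ y, I.graph.IsName y ∧ name y = x := by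
  obtain ⟨b, v⟩ := x
  have h1 : I.code.1 = I.n := rfl
  simp only [names, List.mem_append, List.mem_map, List.mem_filter, List.mem_range, h1,
    Prod.mk.injEq]
  constructor
  · rintro (⟨u, ⟨hu, hk⟩, rfl, rfl⟩ | ⟨u, ⟨hu, hk⟩, rfl, rfl⟩)
    · exact ⟨(false, ⟨u, hu⟩), (keep_iff I hI ⟨u, hu⟩).1 hk, rfl⟩
    · exact ⟨(true, ⟨u, hu⟩), (stub_iff I hI ⟨u, hu⟩).1 hk, rfl⟩
  · rintro ⟨⟨c, u⟩, hu, hx⟩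
    obtain ⟨rfl, rfl⟩ : c = b ∧ u.1 = v := by simpa [name] using hx
    cases c
    · exact .inl ⟨u, ⟨u.isLt, (keep_iff I hI u).2 hu⟩, rfl, rfl⟩
    · exact .inr ⟨u, ⟨u.isLt, (stub_iff I hI u).2 hu⟩, rfl, rfl⟩

theorem nodup_names (I : Code) : (names I).Nodup := by
  refine List.Nodup.append ((List.nodup_range.filter _).map (Prod.mk_right_injective _))
    ((List.nodup_range.filter _).map (Prod.mk_right_injective _)) ?_
  intro x hx hx'
  simp only [List.mem_map] at hx hx'
  obtain ⟨_, _, rfl⟩ := hx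
  obtain ⟨_, _, h⟩ := hx'
  simp at h

/-- The numbering of the vertices of the reduced graph. -/
noncomputable def vertEquiv (hI : I.graph.IsAndOr) :
    {x // I.graph.IsName x} ≃ Fin (names I.code).length :=
  Equiv.ofBijective (fun x => ⟨index I.code (name x.1),
    List.idxOf_lt_length_iff.2 ((mem_names I hI _).2 ⟨_, x.2, rfl⟩)⟩) (by
      constructor
      · intro x y h
        have h := (List.idxOf_inj ((mem_names I hI _).2 ⟨_, x.2, rfl⟩)).1 (Fin.val_eq_of_eq h)
        exact Subtype.ext (name_injective h)
      · intro i
        obtain ⟨y, hy, hi⟩ := (mem_names I hI _).1 (List.getElem_mem i.isLt)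
        refine ⟨⟨y, hy⟩, Fin.ext ?_⟩
        simp only [index, hi]
        exact (nodup_names _).idxOf_getElem _ _)

/-- The edges of the reduced graph in the order of the algorithm. -/
noncomputable def edgeList : List I.graph.ReducedEdge :=
  ((List.finRange I.m).filter fun e => decide (I.graph.KeepEdge e)).pmap (fun e h => .inl ⟨e, h⟩)
      (fun e he => by simpa using he) ++
    ((List.finRange I.n).filter fun v => decide (I.graph.IsStub v)).pmap (fun v h => .inr ⟨v, h⟩)
      (fun v hv => by simpa using hv)

theorem mem_edgeList (e : I.graph.ReducedEdge) : e ∈ edgeList I := by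
  rw [edgeList, List.mem_append]
  rcases e with e | v
  · exact .inl (List.mem_pmap.2 ⟨e.1, by simpa using e.2, rfl⟩)
  · exact .inr (List.mem_pmap.2 ⟨v.1, by simpa using v.2, rfl⟩)

theorem nodup_edgeList : (edgeList I).Nodup := by
  refine List.Nodup.append (((List.nodup_finRange _).filter _).pmap ?_)
    (((List.nodup_finRange _).filter _).pmap ?_) ?_
  · intro a _ b _ h; simpa using h
  · intro a _ b _ h; simpa using h
  · intro x hx hx'
    obtain ⟨_, _, rfl⟩ := List.mem_pmap.1 hx
    obtain ⟨_, _, h⟩ := List.mem_pmap.1 hx'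
    simp at h

/-- The numbering of the edges of the reduced graph. -/
noncomputable def edgeEquiv : Fin (edgeList I).length ≃ I.graph.ReducedEdge :=
  (nodup_edgeList I).getEquivOfForallMemList _ (mem_edgeList I)

theorem name_endName (hI : I.graph.IsAndOr) {x y : Fin I.n} (h : I.graph.KeepAdj x y) :
    name (I.graph.endName h).1 = endName I.code x y := by
  by_cases hx : I.graph.Keep x
  · rw [I.graph.endName_of_keep h hx, endName, if_pos ((keep_iff I hI x).2 hx)]
    rfl
  · rw [I.graph.endName_of_not_keep h hx, endName, if_neg (mt (keep_iff I hI x).1 hx)]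
    rfl

end Code

/-! ### The reduced instance and the output of the algorithm. -/

namespace C2CInstance
open Code
variable (I : C2CInstance)

/-- The reduced instance. -/
noncomputable def kernel (hI : I.graph.IsAndOr) : C2CInstance where
  n := (names I.code).length
  m := (edgeList I).length
  graph := I.graph.reduced.relabel (vertEquiv I hI) (edgeEquiv I)
  ini := I.ini.reduce.relabel _ _
  tar := I.tar.reduce.relabel _ _
  ini_feasible := (Orientation.feasible_relabel _ _ _).2 (Orientation.feasible_reduce I.ini_feasible)
  tar_feasible := (Orientation.feasible_relabel _ _ _).2 (Orientation.feasible_reduce I.tar_feasible)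

theorem isAndOr_kernel (hI : I.graph.IsAndOr) : (I.kernel hI).graph.IsAndOr :=
  hI.reduced.relabel _ _

theorem isYes_kernel (hI : I.graph.IsAndOr) : (I.kernel hI).IsYes ↔ I.IsYes := by
  rw [IsYes, IsYes, Orientation.reachable_iff (I.kernel hI).ini_feasible,
    Orientation.reachable_iff I.ini_feasible,
    Orientation.reach_iff_reach_reduce hI I.ini_feasible I.tar_feasible]
  exact Orientation.reach_relabel _ _ _ _

theorem n_kernel_le (hI : I.graph.IsAndOr) : (I.kernel hI).n ≤ 2 * I.graph.numAnd := by
  refine le_trans (le_of_eq ?_) hI.card_isName_le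
  rw [Fintype.card_congr (vertEquiv I hI), Fintype.card_fin]
  rfl

theorem size_kernel_le (hI : I.graph.IsAndOr) : (I.kernel hI).size ≤ 5 * I.graph.numAnd := by
  have h1 := I.n_kernel_le hI
  have h2 := (I.isAndOr_kernel hI).two_mul_card_edges
  rw [Fintype.card_fin, Fintype.card_fin] at h2
  rw [size]
  omega

theorem numAnd_kernel_le (hI : I.graph.IsAndOr) :
    (I.kernel hI).graph.numAnd ≤ 5 * I.graph.numAnd := by
  have h1 := I.n_kernel_le hI
  have h2 : (I.kernel hI).graph.numAnd ≤ (I.kernel hI).n :=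
    (Finset.card_le_univ _).trans (Fintype.card_fin _).le
  omega

/-- `vertEquiv` and `edgeEquiv` number vertices and edges in the order in which the algorithm lists
them, so the two encodings agree literally and not just up to isomorphism. -/
theorem enc_reduce_code (hI : I.graph.IsAndOr) : enc (reduce I.code) = (I.kernel hI).encode := by
  rw [encode_eq]
  congr 1
  have hedge : ∀ i, (I.kernel hI).edgeCode i = Sum.elim (fun e => reduceEdge I.code (I.edgeCode e.1))
      (fun v => stubLoop I.code v.1) (edgeEquiv I i) := by
    intro i
    have h1 : (I.kernel hI).edgeCode i = (I.graph.reduced.weight (edgeEquiv I i),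
      index I.code (name (I.ini.reduce.arc (edgeEquiv I i)).1.1),
      index I.code (name (I.ini.reduce.arc (edgeEquiv I i)).2.1),
      index I.code (name (I.tar.reduce.arc (edgeEquiv I i)).1.1),
      index I.code (name (I.tar.reduce.arc (edgeEquiv I i)).2.1), ()) := rfl
    rw [h1]
    rcases edgeEquiv I i with e | v
    · simp only [Orientation.reduce, name_endName I hI]
      rfl
    · rfl
  have hlist : (List.finRange (I.kernel hI).m).map (I.kernel hI).edgeCode =
      (edgeList I).map (Sum.elim (fun e => reduceEdge I.code (I.edgeCode e.1))
        (fun v => stubLoop I.code v.1)) := by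
    rw [← List.ofFn_eq_map, ← List.ofFn_getElem_eq_map]
    exact congrArg List.ofFn (funext hedge)
  have hkeep : ∀ e, (keep I.code (I.edgeCode e).a || keep I.code (I.edgeCode e).b) =
      decide (I.graph.KeepEdge e) := by
    intro e
    have ha : keep I.code (I.edgeCode e).a = true ↔ I.graph.Keep (I.ini.arc e).1 := keep_iff I hI _
    have hb : keep I.code (I.edgeCode e).b = true ↔ I.graph.Keep (I.ini.arc e).2 := keep_iff I hI _
    rw [Bool.eq_iff_iff, Bool.or_eq_true, ha, hb, decide_eq_true_eq, ConstraintGraph.KeepEdge]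
    constructor
    · rintro (h | h)
      · exact ⟨_, I.ini.mem_ends.2 (.inl rfl), h⟩
      · exact ⟨_, I.ini.mem_ends.2 (.inr rfl), h⟩
    · rintro ⟨v, hv, h⟩
      rcases I.ini.mem_ends.1 hv with rfl | rfl
      · exact .inl h
      · exact .inr h
  refine Prod.ext rfl ?_
  change _ = (List.finRange (I.kernel hI).m).map (I.kernel hI).edgeCode
  rw [hlist, edgeList, List.map_append, List.map_pmap, List.map_pmap]
  simp only [Sum.elim_inl, Sum.elim_inr]
  rw [List.pmap_eq_map, List.pmap_eq_map]
  have hstub : ∀ v : Fin I.n, stub I.code v = decide (I.graph.IsStub v) := fun v => by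
    rw [Bool.eq_iff_iff, stub_iff I hI, decide_eq_true_eq]
  have h1 : (I.code.2.filter fun e => keep I.code e.a || keep I.code e.b) =
      ((List.finRange I.m).filter fun e => decide (I.graph.KeepEdge e)).map I.edgeCode := by
    rw [code, List.filter_map]
    exact congrArg (fun p => ((List.finRange I.m).filter p).map I.edgeCode) (funext hkeep)
  have h2 : (List.range I.code.1).filter (stub I.code) =
      ((List.finRange I.n).filter fun v => decide (I.graph.IsStub v)).map Fin.val := by
    rw [show I.code.1 = I.n from rfl, ← List.map_coe_finRange_eq_range, List.filter_map]
    exact congrArg (fun p => ((List.finRange I.n).filter p).map Fin.val) (funext hstub)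
  rw [reduce, h1, h2, List.map_map, List.map_map]
  rfl

end C2CInstance
end NCL

theorem corollary3 :
    (∀ (V E : Type) [DecidableEq V] [Fintype V] [Fintype E] (G : NCL.ConstraintGraph V E),
      G.IsAndOr → G.numRed = G.numAnd) ∧
    ∃ C : ℕ, NCL.c2cAndOr.HasKernel (fun k => C * k) := by
  refine ⟨fun V E _ _ _ G hG => hG.numRed_eq_numAnd, 5, ?_⟩
  obtain ⟨P, p, hP⟩ := NCL.Code.polyTime_reduce
  refine ⟨P, p.comp ((8 * .X + 23) * .X + 3), fun I => ?_⟩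
  obtain ⟨t, ht, htp⟩ := hP I.1.code
  rw [NCL.C2CInstance.enc_reduce_code _ I.2, ← NCL.C2CInstance.encode_eq] at ht
  refine ⟨⟨I.1.kernel I.2, I.1.isAndOr_kernel I.2⟩, t, ht, ?_, (I.1.isYes_kernel I.2).symm,
    I.1.size_kernel_le I.2, I.1.numAnd_kernel_le I.2⟩
  refine htp.trans ?_
  rw [Polynomial.eval_comp]
  refine NCL.Polynomial.eval_mono_nat p (I.1.esize_code_le.trans (le_of_eq ?_))
  simp [NCL.c2cAndOr]
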